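/- Let $\Bbbk$ be a field, $n\ge 0$, $R=\Bbbk[x_1,\dots,x_n]$, and let $H$ be a finite abelian group acting on $R$ by $\Bbbk$-algebra automorphisms, diagonally: $h\cdot x_i=h_ix_i$ with $h_i\in\Bbbk^*$. Let $W\in R$ be $H$-invariant (its singularities need not be isolated). For a commutative ring $A$ and a finite ordered set $I$, let $A\langle\theta_i : i\in I\rangle$ be the free $A$-module on the monomials $\theta_J=\theta_{j_1}\cdots\theta_{j_m}$, $J=\{j_1<\dots<j_m\}\subseteq I$, with the operators $\theta_i$ (left multiplication) and $\partial_{\theta_i}$, which satisfy $\theta_i\theta_j=-\theta_j\theta_i$, $\theta_i^2=0$, $\partial_{\theta_i}\partial_{\theta_j}=-\partial_{\theta_j}\partial_{\theta_i}$, $\partial_{\theta_i}^2=0$, $\partial_{\theta_i}\theta_j=-\theta_j\partial_{\theta_i}+\delta_{ij}$; $|\theta_i|=-1$. For $r=(r_i)_{i\in I}$ in $A$, the Koszul complex $K^*(r)$ is $A\langle\theta_i : i\in I\rangle$ with differential $\sum_i r_i\partial_{\theta_i}$, where $K^{-m}(r)$ is spanned by the $\theta_J$ with $|J|=m$. Matrix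 factorizations. For an action of a group $G$ on a commutative ring $A$ and $w\in A$, a $G$-equivariant matrix factorization of $w$ is a $\mathbb Z/2$-graded projective $A$-module $P$ with an odd $A$-linear map $d$ such that $d^2=w\cdot\mathrm{id}$, and with a semilinear degree-preserving $G$-action commuting with $d$. $\mathrm{Hom}_{MF_G(w)}(P,Q)$ is the cohomology of the $\mathbb Z/2$-graded complex of $G$-equivariant $A$-linear maps $\phi:P\to Q$ with $D\phi=d_Q\phi-(-1)^{|\phi|}\phi\, d_P$; it is a $\mathbb Z/2$-graded $A^G$-module. The diagonal. Let $S=\Bbbk[x_1,\dots,x_n,x_1',\dots,x_n']$, with $(a,b)\in H\times H$ acting by $x_i'\mapsto a_ix_i'$, $x_i\mapsto b_ix_i$; let $W\boxminus W=W(x')-W(x)$ and $$\nabla_iW=\frac{W(x_1',\dots,x_i',x_{i+1},\dots,x_n)-W(x_1',\dots,x_{i-1}',x_i,\dots,x_n)}{x_i'-x_i}\in S .$$ Let $\Delta_W^{H\times H}=\bigoplus_{h\in H}\Delta_W^h$, where $\Delta^h_W$ is $S\langle\theta_1,\dots,\theta_n\rangle$ (graded by the parity of $|J|$) with $$d=\sum_{i=1}^n\big((x_i'-h\cdot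 x_i)\,\theta_i+(\nabla_iW)|_{x\mapsto h\cdot x}\;\partial_{\theta_i}\big),$$ and where $(a,b)\in H\times H$ sends $f\theta_J$ in the summand of $h$ to $((a,b)\cdot f)\prod_{j\in J}a_j^{-1}\,\theta_J$ in the summand of $a^{-1}bh$. This is an $H\times H$-equivariant matrix factorization of $W\boxminus W$. Koszul side. For $h\in H$ let $I_h=\{i: h\cdot x_i\ne x_i\}$, $I^h=\{1,\dots,n\}\setminus I_h$, and let $x_i^h=x_i$ for $i\in I^h$, $x_i^h=0$ for $i\in I_h$. Put $W^h=W(x_1^h,\dots,x_n^h)\in\Bbbk[x_i: i\in I^h]$ and $\partial W^h=(\partial_{x_i}W^h)_{i\in I^h}$. A class in $H^i(K^*(\partial W^h))\cdot\theta_{I_h}$ has degree $i-|I_h|$; an element $g\in H$ acts by its action on polynomials and by $g\cdot\theta_j=g_j^{-1}\theta_j$, also on the factors of $\theta_{I_h}$; and $S$ acts through $x_i,x_i'\mapsto x_i^h$. Then there is an isomorphism of $\mathbb Z/2$-graded $S^{H\times H}$-modules $$\mathrm{Hom}_{MF_{H\times H}(W\boxminus W)}\big(\Delta_W^{H\times H},\Delta_W^{H\times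 H}\big)\;\cong\;\Big(\bigoplus_{h\in H}H^*\big(K^*(\partial W^h)\big)\cdot\theta_{I_h}\Big)^H .$$ -/

import Mathlib

open MvPolynomial

noncomputable section

namespace OrbifoldLG

universe u v t

/-! ### The module `A⟨θ_i : i ∈ ι⟩` with the operators `θ_i` and `∂_{θ_i}` -/

section Theta

variable (A : Type*) [CommRing A] {ι : Type*} [LinearOrder ι]

/-- The free `A`-module `A⟨θ_i : i ∈ ι⟩` (`ι` finite and linearly ordered): the coefficient `u J`
belongs to the basis element `θ_J = θ_{j₁} ⋯ θ_{jₘ}`, where `J = {j₁ < ⋯ < jₘ}`. -/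
abbrev Theta (A : Type*) (ι : Type*) : Type _ := Finset ι → A

/-- `(-1)^{#{j ∈ J | j < i}}`, the sign produced by moving `θ_i` to its place in `θ_J`. -/
def thetaSign (i : ι) (J : Finset ι) : A := (-1) ^ (J.filter (· < i)).card

/-- Left multiplication by `θ_i`: it sends `θ_K` to `± θ_{K ∪ {i}}` if `i ∉ K` and to `0` if
`i ∈ K`. -/
def theta (i : ι) : Theta A ι →ₗ[A] Theta A ι where
  toFun u J := if i ∈ J then thetaSign A i J * u (J.erase i) else 0
  map_add' u v := by
    funext J
    by_cases h : i ∈ J <;> simp [h, mul_add]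
  map_smul' a u := by
    funext J
    by_cases h : i ∈ J <;> simp [h, mul_left_comm]

/-- The derivation `∂_{θ_i}`: it sends `θ_K` to `± θ_{K \ {i}}` if `i ∈ K` and to `0` if
`i ∉ K`. -/
def dTheta (i : ι) : Theta A ι →ₗ[A] Theta A ι where
  toFun u J := if i ∈ J then 0 else thetaSign A i J * u (insert i J)
  map_add' u v := by
    funext J
    by_cases h : i ∈ J <;> simp [h, mul_add]
  map_smul' a u := by
    funext J
    by_cases h : i ∈ J <;> simp [h, mul_left_comm]

variable {A}

theorem thetaSign_mul_self (i : ι) (J : Finset ι) : thetaSign A i J * thetaSign A i J = 1 := by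
  rw [thetaSign, ← mul_pow]; simp

theorem thetaSign_insert_self (i : ι) (J : Finset ι) :
    thetaSign A i (insert i J) = thetaSign A i J := by
  simp [thetaSign, Finset.filter_insert]

theorem thetaSign_erase_self (i : ι) (J : Finset ι) :
    thetaSign A i (J.erase i) = thetaSign A i J := by
  by_cases h : i ∈ J
  · conv_rhs => rw [← Finset.insert_erase h]
    rw [thetaSign_insert_self]
  · rw [Finset.erase_eq_of_notMem h]

theorem thetaSign_insert {i j : ι} {J : Finset ι} (hj : j ∉ J) :
    thetaSign A i (insert j J) = (if j < i then -1 else 1) * thetaSign A i J := by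
  unfold thetaSign
  rw [Finset.filter_insert]
  split_ifs with h
  · rw [Finset.card_insert_of_notMem (by simp [hj]), pow_succ]; ring
  · simp

theorem thetaSign_erase {i j : ι} {J : Finset ι} (hj : j ∈ J) :
    thetaSign A i (J.erase j) = (if j < i then -1 else 1) * thetaSign A i J := by
  conv_rhs => rw [← Finset.insert_erase hj]
  rw [thetaSign_insert (Finset.notMem_erase j J)]
  split_ifs <;> simp

theorem theta_sq (i : ι) (u : Theta A ι) : theta A i (theta A i u) = 0 := by
  funext J; simp [theta]

theorem dTheta_sq (i : ι) (u : Theta A ι) : dTheta A i (dTheta A i u) = 0 := by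
  funext J; simp [dTheta]

theorem theta_dTheta_self (i : ι) (u : Theta A ι) :
    theta A i (dTheta A i u) + dTheta A i (theta A i u) = u := by
  funext J
  by_cases h : i ∈ J
  · simp [theta, dTheta, h, thetaSign_erase_self, ← mul_assoc, thetaSign_mul_self]
  · simp [theta, dTheta, h, thetaSign_insert_self, ← mul_assoc, thetaSign_mul_self]

theorem theta_theta {i j : ι} (hij : i ≠ j) (u : Theta A ι) :
    theta A i (theta A j u) + theta A j (theta A i u) = 0 := by
  funext J
  by_cases hi : i ∈ J <;> by_cases hj : j ∈ J
  · simp only [theta, LinearMap.coe_mk, AddHom.coe_mk, Pi.add_apply, Pi.zero_apply, hi, hj,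
      if_true, Finset.mem_erase, hij, hij.symm, ne_eq, not_false_eq_true, and_self,
      thetaSign_erase hi, thetaSign_erase hj, Finset.erase_right_comm (a := i) (b := j)]
    rcases lt_or_gt_of_ne hij with h | h <;> simp [h, h.not_gt] <;> ring
  all_goals simp [theta, hi, hj]

theorem dTheta_dTheta {i j : ι} (hij : i ≠ j) (u : Theta A ι) :
    dTheta A i (dTheta A j u) + dTheta A j (dTheta A i u) = 0 := by
  funext J
  by_cases hi : i ∈ J
  · simp [dTheta, hi]
  by_cases hj : j ∈ J
  · simp [dTheta, hj]
  · simp only [dTheta, LinearMap.coe_mk, AddHom.coe_mk, Pi.add_apply, Pi.zero_apply, hi, hj,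
      if_false, Finset.mem_insert, hij, hij.symm, or_self,
      thetaSign_insert hi, thetaSign_insert hj, Finset.insert_comm i j]
    rcases lt_or_gt_of_ne hij with h | h <;> simp [h, h.not_gt] <;> ring

theorem theta_dTheta {i j : ι} (hij : i ≠ j) (u : Theta A ι) :
    theta A i (dTheta A j u) + dTheta A j (theta A i u) = 0 := by
  funext J
  by_cases hi : i ∈ J
  swap
  · simp [theta, dTheta, hi, hij]
  by_cases hj : j ∈ J
  · simp [theta, dTheta, hj, hij.symm]
  · simp only [theta, dTheta, LinearMap.coe_mk, AddHom.coe_mk, Pi.add_apply, Pi.zero_apply, hi, hj,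
      if_true, if_false, Finset.mem_insert, Finset.mem_erase, hij, or_true, and_false,
      thetaSign_insert hj, thetaSign_erase hi, Finset.erase_insert_of_ne hij.symm]
    rcases lt_or_gt_of_ne hij with h | h <;> simp [h, h.not_gt] <;> ring

/-- The operator `∑_i (a_i θ_i + b_i ∂_{θ_i})`. -/
def cliffordOp [Fintype ι] (a b : ι → A) : Theta A ι →ₗ[A] Theta A ι :=
  ∑ i, (a i • theta A i + b i • dTheta A i)

theorem cliffordOp_apply [Fintype ι] (a b : ι → A) (u : Theta A ι) :
    cliffordOp a b u = ∑ i, (a i • theta A i u + b i • dTheta A i u) := by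
  simp [cliffordOp, LinearMap.sum_apply]

theorem cliffordOp_sq [Fintype ι] (a b : ι → A) (u : Theta A ι) :
    cliffordOp a b (cliffordOp a b u) = (∑ i, a i * b i) • u := by
  let T : ι → Module.End A (Theta A ι) := fun i => a i • theta A i + b i • dTheta A i
  have hT : ∀ i, T i * T i = (a i * b i) • 1 := by
    intro i
    refine LinearMap.ext fun u => ?_
    have h1 := theta_sq i u
    have h2 := dTheta_sq i u
    have h3 := theta_dTheta_self i u
    simp only [T, Module.End.mul_apply, LinearMap.add_apply, LinearMap.smul_apply, map_add,
      map_smul, h1, h2, smul_zero, zero_add, add_zero, Module.End.one_apply]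
    conv_rhs => rw [← h3]
    module
  have hTT : ∀ i j, i ≠ j → T i * T j + T j * T i = 0 := by
    intro i j hij
    refine LinearMap.ext fun u => ?_
    have h1 := theta_theta hij u
    have h2 := dTheta_dTheta hij u
    have h3 := theta_dTheta hij u
    have h4 := theta_dTheta hij.symm u
    rw [add_eq_zero_iff_eq_neg] at h1 h2 h3 h4
    simp only [T, Module.End.mul_apply, LinearMap.add_apply, LinearMap.smul_apply, map_add,
      map_smul, h1, h2, h3, h4, LinearMap.zero_apply]
    module
  have key : ∀ s : Finset ι, (∑ i ∈ s, T i) * (∑ i ∈ s, T i) = (∑ i ∈ s, a i * b i) • 1 := by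
    intro s
    induction s using Finset.induction_on with
    | empty => simp
    | insert i s his ih =>
      have hc : T i * (∑ j ∈ s, T j) + (∑ j ∈ s, T j) * T i = 0 := by
        rw [Finset.mul_sum, Finset.sum_mul, ← Finset.sum_add_distrib]
        exact Finset.sum_eq_zero fun j hj => hTT i j (by rintro rfl; exact his hj)
      rw [Finset.sum_insert his, Finset.sum_insert his, add_smul, ← ih, ← hT i]
      calc _ = T i * T i + (T i * (∑ j ∈ s, T j) + (∑ j ∈ s, T j) * T i)
            + (∑ j ∈ s, T j) * (∑ j ∈ s, T j) := by noncomm_ring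
        _ = _ := by rw [hc, add_zero]
  have := congrArg (fun f : Module.End A (Theta A ι) => f u) (key Finset.univ)
  simpa [cliffordOp, T] using this

end Theta

/-! ### The Koszul complex -/

section Koszul

variable {A : Type*} [CommRing A] {ι : Type*} [LinearOrder ι]

/-- The degree `i` part of the Koszul complex; since `|θ_j| = -1`, it is spanned by the `θ_J` with
`-|J| = i`. -/
def koszulDeg (A : Type*) [CommRing A] (ι : Type*) (i : ℤ) : Submodule A (Theta A ι) where
  carrier := {u | ∀ J, u J ≠ 0 → -(J.card : ℤ) = i}
  zero_mem' := by simp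
  add_mem' := by
    intro u v hu hv J h
    by_cases h1 : u J = 0
    · exact hv J (by simpa [h1] using h)
    · exact hu J h1
  smul_mem' := by
    intro a u hu J h
    exact hu J fun h1 => h (by simp [h1])

/-- The differential `∑_i r_i ∂_{θ_i}` of the Koszul complex `K^*(r)`. -/
def koszulD [Fintype ι] (r : ι → A) : Theta A ι →ₗ[A] Theta A ι := ∑ i, r i • dTheta A i

/-- The cocycles of degree `i` of `K^*(r)`. -/
def koszulCocycles [Fintype ι] (r : ι → A) (i : ℤ) : Submodule A (Theta A ι) :=
  LinearMap.ker (koszulD r) ⊓ koszulDeg A ι i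

/-- The coboundaries of degree `i` of `K^*(r)`. -/
def koszulCoboundaries [Fintype ι] (r : ι → A) (i : ℤ) : Submodule A (Theta A ι) :=
  (koszulDeg A ι (i - 1)).map (koszulD r)

/-- The cohomology `H^i(K^*(r))`. -/
abbrev koszulCohomology [Fintype ι] (r : ι → A) (i : ℤ) : Type _ :=
  ↥(koszulCocycles r i) ⧸ (koszulCoboundaries r i).submoduleOf (koszulCocycles r i)

end Koszul

/-! ### Equivariant matrix factorizations -/

section MF

variable {R : Type u} [CommRing R] {G : Type v} [Group G]

/-- The ring of invariants `R^G` of an action of `G` on `R` by ring automorphisms. -/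
def invariants (ρ : G →* RingAut R) : Subring R where
  carrier := {r | ∀ g, ρ g r = r}
  zero_mem' g := map_zero _
  one_mem' g := map_one _
  add_mem' ha hb g := by rw [map_add, ha g, hb g]
  mul_mem' ha hb g := by rw [map_mul, ha g, hb g]
  neg_mem' ha g := by rw [map_neg, ha g]

/-- A `G`-equivariant matrix factorization of `w ∈ R`, where `G` acts on `R` through `ρ`: a
`ℤ/2`-graded projective `R`-module with an odd `R`-linear map `d` such that `d² = w · id`, and
with a (semilinear, degree-preserving) action of `G` that commutes with `d`. -/
structure EquivMF (ρ : G →* RingAut R) (w : R) where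
  carrier : Type t
  [addCommGroup : AddCommGroup carrier]
  [module : Module R carrier]
  projective : Module.Projective R carrier
  grading : ZMod 2 → Submodule R carrier
  isInternal : DirectSum.IsInternal grading
  d : carrier →ₗ[R] carrier
  d_mem : ∀ i x, x ∈ grading i → d x ∈ grading (i + 1)
  d_sq : ∀ x, d (d x) = w • x
  act : G →* AddMonoid.End carrier
  act_smul : ∀ g (r : R) x, act g (r • x) = ρ g r • act g x
  act_mem : ∀ g i x, x ∈ grading i → act g x ∈ grading i
  act_d : ∀ g x, act g (d x) = d (act g x)

attribute [instance] EquivMF.addCommGroup EquivMF.module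

variable {ρ : G →* RingAut R} {w : R}

/-- The `G`-equivariant `R`-linear maps of degree `j` between two equivariant matrix
factorizations, a module over `R^G`. -/
def homDeg (P Q : EquivMF.{u, v, t} ρ w) (j : ZMod 2) :
    Submodule (invariants ρ) (P.carrier →ₗ[R] Q.carrier) where
  carrier := {φ | (∀ g x, φ (P.act g x) = Q.act g (φ x)) ∧
    ∀ i x, x ∈ P.grading i → φ x ∈ Q.grading (i + j)}
  zero_mem' := ⟨fun g x => by simp, fun i x _ => by simp⟩
  add_mem' := by
    rintro φ ψ ⟨h1, h2⟩ ⟨h3, h4⟩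
    exact ⟨fun g x => by simp [h1, h3], fun i x hx => add_mem (h2 i x hx) (h4 i x hx)⟩
  smul_mem' := by
    rintro ⟨a, ha⟩ φ ⟨h1, h2⟩
    refine ⟨fun g x => ?_, fun i x hx => Submodule.smul_mem _ a (h2 i x hx)⟩
    change a • φ (P.act g x) = Q.act g (a • φ x)
    rw [Q.act_smul, ha g, h1]

/-- The differential `D φ = d' ∘ φ - (-1)^{|φ|} φ ∘ d` on morphisms of degree `|φ| = j`. -/
def homD (P Q : EquivMF.{u, v, t} ρ w) (j : ZMod 2) :
    (P.carrier →ₗ[R] Q.carrier) →ₗ[invariants ρ] (P.carrier →ₗ[R] Q.carrier) where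
  toFun φ := Q.d ∘ₗ φ - (-1 : R) ^ j.val • (φ ∘ₗ P.d)
  map_add' φ ψ := by
    simp only [LinearMap.comp_add, LinearMap.add_comp, smul_add]; abel
  map_smul' := by
    rintro ⟨a, ha⟩ φ
    ext x
    change Q.d (a • φ x) - (-1 : R) ^ j.val • (a • φ (P.d x)) =
      a • (Q.d (φ x) - (-1 : R) ^ j.val • φ (P.d x))
    rw [map_smul, smul_sub, smul_comm]

/-- Closed morphisms of degree `j`. -/
def homCocycles (P Q : EquivMF.{u, v, t} ρ w) (j : ZMod 2) :
    Submodule (invariants ρ) (P.carrier →ₗ[R] Q.carrier) :=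
  LinearMap.ker (homD P Q j) ⊓ homDeg P Q j

/-- Exact morphisms of degree `j`. -/
def homCoboundaries (P Q : EquivMF.{u, v, t} ρ w) (j : ZMod 2) :
    Submodule (invariants ρ) (P.carrier →ₗ[R] Q.carrier) :=
  (homDeg P Q (j - 1)).map (homD P Q (j - 1))

/-- The degree `j` part of `Hom_{MF_G(w)}(P, Q)`, that is, the degree `j` cohomology of the
`ℤ/2`-graded complex of equivariant morphisms. -/
abbrev HomMF (P Q : EquivMF.{u, v, t} ρ w) (j : ZMod 2) : Type _ :=
  ↥(homCocycles P Q j) ⧸ (homCoboundaries P Q j).submoduleOf (homCocycles P Q j)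

end MF

/-! ### Diagonal actions on polynomial rings -/

section Diagonal

variable {k : Type*} [CommRing k] {G : Type*} [Group G] {σ : Type*}

/-- The action of `G` on `k[x_i : i ∈ σ]` by `k`-algebra automorphisms with
`g · x_i = c_i(g) x_i`. -/
def diagAction (c : σ → G →* kˣ) : G →* RingAut (MvPolynomial σ k) where
  toFun g := (AlgEquiv.ofAlgHom
      (aeval fun i => C (c i g : k) * X i)
      (aeval fun i => C (c i g⁻¹ : k) * X i)
      (by ext i; simp [← mul_assoc, ← C_mul, ← Units.val_mul])
      (by ext i; simp [← mul_assoc, ← C_mul, ← Units.val_mul]) :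
        MvPolynomial σ k ≃ₐ[k] MvPolynomial σ k).toRingEquiv
  map_one' := by
    apply RingEquiv.ext
    intro p
    change aeval _ p = p
    simp only [map_one, Units.val_one, one_mul]
    exact aeval_X_left_apply p
  map_mul' g h := by
    apply RingEquiv.ext
    intro p
    change aeval _ p = aeval _ (aeval _ p)
    rw [← AlgHom.comp_apply]
    congr 1
    ext i
    simp [mul_assoc, mul_left_comm]

theorem diagAction_apply (c : σ → G →* kˣ) (g : G) (p : MvPolynomial σ k) :
    diagAction c g p = aeval (fun i => C (c i g : k) * X i) p := rfl

@[simp] theorem diagAction_X (c : σ → G →* kˣ) (g : G) (i : σ) :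
    diagAction c g (X i) = C (c i g : k) * X i := by simp [diagAction_apply]

@[simp] theorem diagAction_C (c : σ → G →* kˣ) (g : G) (a : k) :
    diagAction c g (C a) = C a := by simp [diagAction_apply, algebraMap_eq]

theorem diagAction_mul (c : σ → G →* kˣ) (g h : G) (p : MvPolynomial σ k) :
    diagAction c (g * h) p = diagAction c g (diagAction c h p) := by
  rw [map_mul]; rfl

theorem pderiv_diagAction (c : σ → G →* kˣ) (g : G) (i : σ) (p : MvPolynomial σ k) :
    pderiv i (diagAction c g p) = C (c i g : k) * diagAction c g (pderiv i p) := by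
  induction p using MvPolynomial.induction_on with
  | C a => simp
  | add p q hp hq => simp [hp, hq, mul_add]
  | mul_X p j hp =>
    by_cases h : i = j
    · subst h
      simp [hp]; ring
    · simp [hp, pderiv_X_of_ne (Ne.symm h)]; ring

end Diagonal

/-! ### The twisted diagonal matrix factorization -/

section Diagonal

variable {k : Type u} [Field k] {n : ℕ} {H : Type v} [CommGroup H] (χ : Fin n → H →* kˣ)

/-- The polynomial ring `S = k[x_1, …, x_n, x_1', …, x_n']`; the variable `x_i` is `X (inl i)` and
`x_i'` is `X (inr i)`. -/
abbrev DoubleRing (k : Type u) [Field k] (n : ℕ) : Type u := MvPolynomial (Fin n ⊕ Fin n) k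

/-- The action of `H × H` on `S`: `(a, b) · x_i' = a_i x_i'` and `(a, b) · x_i = b_i x_i`, where
`h_i = χ i h`. -/
def doubleAction : H × H →* RingAut (DoubleRing k n) :=
  diagAction (Sum.elim (fun i => (χ i).comp (MonoidHom.snd H H))
    (fun i => (χ i).comp (MonoidHom.fst H H)))

/-- `W ⊟ W = W(x_1', …, x_n') - W(x_1, …, x_n)`. -/
def boxminus (W : MvPolynomial (Fin n) k) : DoubleRing k n :=
  rename Sum.inr W - rename Sum.inl W

/-- `W(x_1', …, x_m', x_{m+1}, …, x_n)`. -/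
def mixedSubst (W : MvPolynomial (Fin n) k) (m : ℕ) : DoubleRing k n :=
  aeval (fun j : Fin n => if j.val < m then (X (Sum.inr j) : DoubleRing k n) else X (Sum.inl j)) W

theorem nabla_dvd (W : MvPolynomial (Fin n) k) (i : Fin n) :
    (X (Sum.inr i) - X (Sum.inl i) : DoubleRing k n) ∣
      mixedSubst W (i.val + 1) - mixedSubst W i.val := by
  rw [← Ideal.mem_span_singleton, ← Ideal.Quotient.eq]
  unfold mixedSubst
  change (Ideal.Quotient.mkₐ k _) (aeval _ W) = (Ideal.Quotient.mkₐ k _) (aeval _ W)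
  rw [← AlgHom.comp_apply, ← AlgHom.comp_apply]
  congr 1
  ext j
  simp only [AlgHom.coe_comp, Function.comp_apply, aeval_X, Ideal.Quotient.mkₐ_eq_mk]
  by_cases h : j = i
  · subst h
    simp only [lt_add_iff_pos_right, zero_lt_one, if_true, lt_irrefl, if_false]
    rw [Ideal.Quotient.eq, Ideal.mem_span_singleton]
  · have : j.val < i.val + 1 ↔ j.val < i.val := by
      have : j.val ≠ i.val := fun e => h (Fin.ext e)
      omega
    simp only [this]

/-- `∇_i W`, the quotient of `W(x_1', …, x_i', x_{i+1}, …) - W(x_1', …, x_{i-1}', x_i, …)` by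
`x_i' - x_i` in `S`. -/
def nabla (W : MvPolynomial (Fin n) k) (i : Fin n) : DoubleRing k n :=
  Classical.choose (nabla_dvd W i)

theorem nabla_spec (W : MvPolynomial (Fin n) k) (i : Fin n) :
    mixedSubst W (i.val + 1) - mixedSubst W i.val =
      (X (Sum.inr i) - X (Sum.inl i)) * nabla W i :=
  Classical.choose_spec (nabla_dvd W i)

theorem sum_nabla (W : MvPolynomial (Fin n) k) :
    ∑ i, (X (Sum.inr i) - X (Sum.inl i)) * nabla W i = boxminus W := by
  simp only [← nabla_spec]
  rw [Fin.sum_univ_eq_sum_range (fun m => mixedSubst W (m + 1) - mixedSubst W m) n,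
    Finset.sum_range_sub]
  unfold boxminus mixedSubst
  congr 1
  · rw [rename_eq_aeval]
    congr 2
    funext j
    simp
  · rw [rename_eq_aeval]
    congr 2

theorem X_sub_X_ne_zero (i : Fin n) :
    (X (Sum.inr i) - X (Sum.inl i) : DoubleRing k n) ≠ 0 := by
  rw [sub_ne_zero]
  exact fun h => by simpa using X_injective h

variable {χ} {W : MvPolynomial (Fin n) k}

theorem doubleAction_diag_nabla (hW : ∀ h, diagAction χ h W = W) (a : H) (i : Fin n) :
    doubleAction χ (a, a) (nabla W i) = C ((χ i a)⁻¹ : kˣ).val * nabla W i := by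
  have hm : ∀ m, doubleAction χ (a, a) (mixedSubst W m) = mixedSubst W m := by
    intro m
    conv_rhs => rw [← hW a]
    unfold mixedSubst doubleAction
    rw [diagAction_apply, diagAction_apply, ← AlgHom.comp_apply, ← AlgHom.comp_apply]
    congr 1
    ext1 j
    by_cases h : j.val < m <;> simp [h, algebraMap_eq]
  have h1 := congrArg (doubleAction χ (a, a)) (nabla_spec W i)
  rw [map_sub, hm, hm, nabla_spec, map_mul, map_sub] at h1
  simp only [doubleAction, diagAction_X, Sum.elim_inl, Sum.elim_inr, MonoidHom.comp_apply,
    MonoidHom.coe_fst, MonoidHom.coe_snd] at h1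
  rw [← mul_sub, mul_assoc, mul_left_comm] at h1
  have h2 := mul_left_cancel₀ (X_sub_X_ne_zero i) h1
  rw [doubleAction]
  conv_rhs => rw [h2]
  rw [← mul_assoc, ← C_mul]
  simp

theorem doubleAction_boxminus (hW : ∀ h, diagAction χ h W = W) (g : H × H) :
    doubleAction χ g (boxminus W) = boxminus W := by
  unfold boxminus
  rw [map_sub]
  congr 1
  · conv_rhs => rw [← hW g.1]
    rw [doubleAction, diagAction_apply, diagAction_apply, ← AlgHom.comp_apply, ← AlgHom.comp_apply]
    congr 1
    ext1 j
    simp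
  · conv_rhs => rw [← hW g.2]
    rw [doubleAction, diagAction_apply, diagAction_apply, ← AlgHom.comp_apply, ← AlgHom.comp_apply]
    congr 1
    ext1 j
    simp

variable (χ W)

/-- The coefficient `x_i' - h · x_i`. -/
def coeffTheta (h : H) (i : Fin n) : DoubleRing k n :=
  X (Sum.inr i) - C (χ i h : k) * X (Sum.inl i)

/-- The coefficient `∇_i W |_{h · x → x}`, in which `x_i` is replaced by `h · x_i` and `x_i'` is
kept. -/
def coeffDTheta (h : H) (i : Fin n) : DoubleRing k n := doubleAction χ (1, h) (nabla W i)

/-- The differential `∑_i ((x_i' - h · x_i) θ_i + (∇_i W)|_{h · x → x} ∂_{θ_i})` of the summand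
`Δ_W^h`. -/
def diagD (h : H) : Theta (DoubleRing k n) (Fin n) →ₗ[DoubleRing k n]
    Theta (DoubleRing k n) (Fin n) :=
  cliffordOp (coeffTheta χ h) (coeffDTheta χ W h)

/-- The part of `S⟨θ_1, …, θ_n⟩` of parity `p`. -/
def parityPart (A : Type*) [CommRing A] (ι : Type*) (p : ZMod 2) : Submodule A (Theta A ι) where
  carrier := {u | ∀ J, u J ≠ 0 → (J.card : ZMod 2) = p}
  zero_mem' := by simp
  add_mem' := by
    intro u v hu hv J h
    by_cases h1 : u J = 0
    · exact hv J (by simpa [h1] using h)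
    · exact hu J h1
  smul_mem' := by
    intro a u hu J h
    exact hu J fun h1 => h (by simp [h1])

/-- The scalar by which `g` acts on `θ_J`: `g · θ_J = (∏_{j ∈ J} g_j⁻¹) θ_J`. -/
def thetaWeight {ι : Type*} (c : ι → H →* kˣ) (g : H) (J : Finset ι) : kˣ := ∏ j ∈ J, (c j g)⁻¹

theorem theta_mem_parityPart {A : Type*} [CommRing A] {ι : Type*} [LinearOrder ι] (i : ι)
    {p : ZMod 2} {u : Theta A ι} (hu : u ∈ parityPart A ι p) :
    theta A i u ∈ parityPart A ι (p + 1) := by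
  intro J hJ
  by_cases h : i ∈ J
  · have h1 : u (J.erase i) ≠ 0 := fun h2 => hJ (by simp [theta, h2])
    rw [← hu _ h1, ← Finset.card_erase_add_one h]
    push_cast; rfl
  · exact absurd (by simp [theta, h]) hJ

theorem dTheta_mem_parityPart {A : Type*} [CommRing A] {ι : Type*} [LinearOrder ι] (i : ι)
    {p : ZMod 2} {u : Theta A ι} (hu : u ∈ parityPart A ι p) :
    dTheta A i u ∈ parityPart A ι (p + 1) := by
  intro J hJ
  by_cases h : i ∈ J
  · exact absurd (by simp [dTheta, h]) hJ
  · have h1 : u (insert i J) ≠ 0 := fun h2 => hJ (by simp [dTheta, h2])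
    rw [← hu _ h1, Finset.card_insert_of_notMem h]
    push_cast
    rw [add_assoc, show (1 + 1 : ZMod 2) = 0 from rfl, add_zero]

theorem cliffordOp_mem_parityPart {A : Type*} [CommRing A] {ι : Type*} [LinearOrder ι] [Fintype ι]
    (a b : ι → A) {p : ZMod 2} {u : Theta A ι} (hu : u ∈ parityPart A ι p) :
    cliffordOp a b u ∈ parityPart A ι (p + 1) := by
  rw [cliffordOp_apply]
  exact Submodule.sum_mem _ fun i _ => add_mem
    (Submodule.smul_mem _ _ (theta_mem_parityPart i hu))
    (Submodule.smul_mem _ _ (dTheta_mem_parityPart i hu))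

theorem thetaWeight_mul {ι : Type*} (c : ι → H →* kˣ) (g h : H) (J : Finset ι) :
    thetaWeight c (g * h) J = thetaWeight c g J * thetaWeight c h J := by
  simp [thetaWeight, mul_comm, Finset.prod_mul_distrib]

theorem thetaWeight_erase {ι : Type*} [LinearOrder ι] (c : ι → H →* kˣ) (g : H) {J : Finset ι}
    {i : ι} (hi : i ∈ J) : thetaWeight c g (J.erase i) = c i g * thetaWeight c g J := by
  rw [thetaWeight, thetaWeight, ← Finset.mul_prod_erase J _ hi]
  simp

theorem thetaWeight_insert {ι : Type*} [LinearOrder ι] (c : ι → H →* kˣ) (g : H) {J : Finset ι}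
    {i : ι} (hi : i ∉ J) :
    thetaWeight c g (insert i J) = (c i g)⁻¹ * thetaWeight c g J := by
  rw [thetaWeight, thetaWeight, Finset.prod_insert hi]

/-- The grading of `⨁_h S⟨θ_1, …, θ_n⟩` by the parity of the number of `θ`s. -/
def diagGrading (H : Type v) (A : Type*) [CommRing A] (n : ℕ) (p : ZMod 2) :
    Submodule A (H → Theta A (Fin n)) :=
  Submodule.pi Set.univ fun _ => parityPart A (Fin n) p

theorem diagGrading_isInternal (H : Type v) (A : Type*) [CommRing A] (n : ℕ) :
    DirectSum.IsInternal (diagGrading H A n) := by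
  rw [DirectSum.isInternal_submodule_iff_isCompl (diagGrading H A n) (i := 0) (j := 1)
    (by decide) (by
      have h2 : ∀ p : ZMod 2, p = 0 ∨ p = 1 := by decide
      ext p; simpa using h2 p)]
  constructor
  · rw [Submodule.disjoint_def]
    intro x h0 h1
    funext h J
    by_contra hne
    exact absurd ((h0 h trivial J hne).symm.trans (h1 h trivial J hne)) (by decide)
  · rw [codisjoint_iff, eq_top_iff]
    intro x _
    rw [Submodule.mem_sup]
    refine ⟨fun h J => if (J.card : ZMod 2) = 0 then x h J else 0, ?_,
      fun h J => if (J.card : ZMod 2) = 0 then 0 else x h J, ?_, ?_⟩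
    · intro h _ J hJ
      by_contra hc
      exact hJ (if_neg hc)
    · intro h _ J hJ
      have h2 : ∀ p : ZMod 2, p ≠ 0 → p = 1 := by decide
      exact h2 _ fun hc => hJ (if_pos hc)
    · funext h J
      by_cases hc : (J.card : ZMod 2) = 0 <;> simp [hc]

/-- The action of `(a, b) ∈ H × H` on `⨁_h S⟨θ_1, …, θ_n⟩`: it sends `f θ_J` in the summand of `h`
to `((a, b) · f) (∏_{j ∈ J} a_j⁻¹) θ_J` in the summand of `a⁻¹ b h`. -/
def diagAct : H × H →* AddMonoid.End (H → Theta (DoubleRing k n) (Fin n)) where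
  toFun g :=
    { toFun := fun u h J => C (thetaWeight χ g.1 J : k) *
        doubleAction χ g (u (g.1 * g.2⁻¹ * h) J)
      map_zero' := by funext h J; simp
      map_add' := fun u v => by funext h J; simp [mul_add] }
  map_one' := by
    ext1 u
    funext h J
    simp [thetaWeight]
    rfl
  map_mul' g g' := by
    ext1 u
    funext h J
    change C (thetaWeight χ (g.1 * g'.1) J : k) *
        doubleAction χ (g * g') (u (g.1 * g'.1 * (g.2 * g'.2)⁻¹ * h) J) =
      C (thetaWeight χ g.1 J : k) * doubleAction χ g (C (thetaWeight χ g'.1 J : k) *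
        doubleAction χ g' (u (g'.1 * g'.2⁻¹ * (g.1 * g.2⁻¹ * h)) J))
    rw [thetaWeight_mul, show g.1 * g'.1 * (g.2 * g'.2)⁻¹ * h =
      g'.1 * g'.2⁻¹ * (g.1 * g.2⁻¹ * h) by rw [mul_inv]; ac_rfl, map_mul (doubleAction χ g)]
    simp only [doubleAction, diagAction_mul, diagAction_C, Units.val_mul, C_mul]
    ring

variable {W}

/-- The `H × H`-equivariant matrix factorization `Δ_W^{H × H} = ⨁_h Δ_W^h` of `W ⊟ W`. -/
def diagonalMF [Finite H] (hW : ∀ h, diagAction χ h W = W) :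
    EquivMF.{u, v, max u v} (doubleAction χ) (boxminus W) where
  carrier := H → Theta (DoubleRing k n) (Fin n)
  projective := inferInstance
  grading := diagGrading H (DoubleRing k n) n
  isInternal := diagGrading_isInternal H (DoubleRing k n) n
  d := LinearMap.pi fun h => diagD χ W h ∘ₗ LinearMap.proj h
  d_mem := by
    intro i x hx h _
    exact cliffordOp_mem_parityPart _ _ (hx h trivial)
  d_sq := by
    intro x
    funext h
    change diagD χ W h (diagD χ W h (x h)) = boxminus W • x h
    rw [diagD, cliffordOp_sq]
    congr 1
    have := congrArg (doubleAction χ (1, h)) (sum_nabla W)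
    rw [doubleAction_boxminus hW, map_sum] at this
    rw [← this]
    refine Finset.sum_congr rfl fun i _ => ?_
    rw [map_mul]
    simp [coeffTheta, coeffDTheta, doubleAction]
  act := diagAct χ
  act_smul := by
    intro g r x
    funext h J
    change C _ * doubleAction χ g (r * _) = doubleAction χ g r * (C _ * _)
    rw [map_mul]; ring
  act_mem := by
    intro g i x hx h _ J hJ
    refine hx (g.1 * g.2⁻¹ * h) trivial J fun h1 => hJ ?_
    change C _ * doubleAction χ g (x (g.1 * g.2⁻¹ * h) J) = 0
    rw [h1]; simp
  act_d := by
    intro g x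
    funext h J
    change C (thetaWeight χ g.1 J : k) *
      doubleAction χ g (diagD χ W (g.1 * g.2⁻¹ * h) (x (g.1 * g.2⁻¹ * h)) J) =
      diagD χ W h (diagAct χ g x h) J
    have e1 : ∀ i, doubleAction χ g (coeffTheta χ (g.1 * g.2⁻¹ * h) i) =
        C (χ i g.1 : k) * coeffTheta χ h i := by
      intro i
      simp only [coeffTheta, doubleAction, map_sub, map_mul, diagAction_X, diagAction_C,
        Sum.elim_inl, Sum.elim_inr, MonoidHom.comp_apply, MonoidHom.coe_fst, MonoidHom.coe_snd,
        mul_sub, ← mul_assoc, ← C_mul, ← Units.val_mul]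
      congr 4
      rw [← map_mul, mul_right_comm, ← map_mul, inv_mul_cancel_right]
    have e2 : ∀ i, doubleAction χ g (coeffDTheta χ W (g.1 * g.2⁻¹ * h) i) =
        C ((χ i g.1)⁻¹ : kˣ).val * coeffDTheta χ W h i := by
      intro i
      unfold coeffDTheta
      rw [← (show doubleAction χ (1, h) (doubleAction χ (g.1, g.1) (nabla W i)) =
        doubleAction χ g (doubleAction χ (1, g.1 * g.2⁻¹ * h) (nabla W i)) from ?_),
        doubleAction_diag_nabla hW, map_mul]
      · congr 1
        simp [doubleAction]
      · unfold doubleAction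
        rw [← diagAction_mul, ← diagAction_mul]
        congr 2
        ext
        · simp
        · simp only [Prod.snd_mul]
          rw [mul_comm g.2, mul_right_comm, inv_mul_cancel_right, mul_comm]
    have e3 : ∀ K, diagAct χ g x h K =
        C (thetaWeight χ g.1 K : k) * doubleAction χ g (x (g.1 * g.2⁻¹ * h) K) := fun K => rfl
    have e4 : ∀ (i : Fin n) (K : Finset (Fin n)),
        doubleAction χ g (thetaSign (DoubleRing k n) i K) = thetaSign (DoubleRing k n) i K := by
      intro i K; simp [thetaSign]
    simp only [diagD, cliffordOp_apply, Finset.sum_apply, map_sum, Finset.mul_sum, Pi.add_apply,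
      Pi.smul_apply, smul_eq_mul, map_add, map_mul, e1, e2]
    refine Finset.sum_congr rfl fun i _ => ?_
    by_cases hi : i ∈ J
    · simp only [theta, dTheta, LinearMap.coe_mk, AddHom.coe_mk, hi, if_true, map_zero, mul_zero,
        add_zero, e3, map_mul, e4, thetaWeight_erase χ g.1 hi, Units.val_mul]
      ring
    · simp only [theta, dTheta, LinearMap.coe_mk, AddHom.coe_mk, hi, if_false, map_zero, mul_zero,
        zero_add, e3, map_mul, e4, thetaWeight_insert χ g.1 hi, Units.val_mul]
      ring

end Diagonal

/-! ### Orbifold Koszul cohomology -/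

section Sector

variable {k : Type u} [Field k] {n : ℕ} {H : Type v} [CommGroup H] (χ : Fin n → H →* kˣ)

/-- `I_h`, the set of the `i` with `h · x_i ≠ x_i`. -/
def movedIdx (h : H) : Finset (Fin n) := by
  classical exact Finset.univ.filter fun i => χ i h ≠ 1

/-- `I^h`, the set of the `i` with `h · x_i = x_i`. -/
abbrev FixedIdx (h : H) : Type := {i : Fin n // χ i h = 1}

instance fixedIdxFintype (h : H) : Fintype (FixedIdx χ h) := Fintype.ofFinite _

/-- The ring `k[x_i : i ∈ I^h]`. -/
abbrev FixedRing (h : H) : Type u := MvPolynomial (FixedIdx χ h) k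

/-- The element `x_i^h` of `k[x_i : i ∈ I^h]`. -/
def fixedVar (h : H) (i : Fin n) : FixedRing χ h := by
  classical exact if hi : χ i h = 1 then X ⟨i, hi⟩ else 0

/-- `W^h = W(x_1^h, …, x_n^h)`. -/
def restrictW (W : MvPolynomial (Fin n) k) (h : H) : FixedRing χ h := aeval (fixedVar χ h) W

/-- The generators `∂_{x_i} W^h`, `i ∈ I^h`, of the Jacobian ideal of `W^h`. -/
def jacobian (W : MvPolynomial (Fin n) k) (h : H) (i : FixedIdx χ h) : FixedRing χ h :=
  pderiv i (restrictW χ W h)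

/-- The restriction `S → k[x_i : i ∈ I^h]` with `x_i, x_i' ↦ x_i^h`. -/
def restrictS (h : H) : DoubleRing k n →ₐ[k] FixedRing χ h :=
  aeval (Sum.elim (fixedVar χ h) (fixedVar χ h))

/-- The action of `H` on the ring `k[x_i : i ∈ I^h]`. -/
def fixedAction (h : H) : H →* RingAut (FixedRing χ h) :=
  diagAction fun i : FixedIdx χ h => χ i.val

/-- The action of `g ∈ H` on the shifted Koszul complex `K^*(∂W^h) · θ_{I_h}`: the element
`f θ_J θ_{I_h}` goes to `(g · f) (∏_{j ∈ J} g_j⁻¹) (∏_{j ∈ I_h} g_j⁻¹) θ_J θ_{I_h}`. An element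
`u · θ_{I_h}` is represented by `u`. -/
def sectorAct (h g : H) : Theta (FixedRing χ h) (FixedIdx χ h)
    →ₛₗ[(fixedAction χ h g : FixedRing χ h →+* FixedRing χ h)] Theta (FixedRing χ h) (FixedIdx χ h) where
  toFun u J := C (thetaWeight χ g (movedIdx χ h) *
    thetaWeight (fun i : FixedIdx χ h => χ i.val) g J : kˣ).val * fixedAction χ h g (u J)
  map_add' u v := by funext J; simp [mul_add]
  map_smul' a u := by
    funext J
    simp only [Pi.smul_apply, smul_eq_mul, map_mul, RingHom.coe_coe]
    ring

theorem fixedAction_restrictS (h g : H) (s : DoubleRing k n) :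
    fixedAction χ h g (restrictS χ h s) = restrictS χ h (doubleAction χ (g, g) s) := by
  unfold fixedAction doubleAction restrictS
  rw [diagAction_apply, diagAction_apply, ← AlgHom.comp_apply, ← AlgHom.comp_apply]
  congr 1
  ext1 j
  rcases j with j | j <;> by_cases hj : χ j h = 1 <;> simp [fixedVar, hj, algebraMap_eq]

theorem fixedAction_restrictW {W : MvPolynomial (Fin n) k} (hW : ∀ h, diagAction χ h W = W)
    (h g : H) : fixedAction χ h g (restrictW χ W h) = restrictW χ W h := by
  conv_rhs => rw [← hW g]
  unfold fixedAction restrictW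
  rw [diagAction_apply, diagAction_apply, ← AlgHom.comp_apply, ← AlgHom.comp_apply]
  congr 1
  ext1 j
  by_cases hj : χ j h = 1 <;> simp [fixedVar, hj, algebraMap_eq]

theorem fixedAction_jacobian {W : MvPolynomial (Fin n) k} (hW : ∀ h, diagAction χ h W = W)
    (h g : H) (i : FixedIdx χ h) : fixedAction χ h g (jacobian χ W h i) =
      C ((χ i.val g)⁻¹ : kˣ).val * jacobian χ W h i := by
  have h1 := pderiv_diagAction (fun i : FixedIdx χ h => χ i.val) g i (restrictW χ W h)
  have h2 := fixedAction_restrictW χ hW h g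
  unfold fixedAction at h2 ⊢
  rw [h2] at h1
  unfold jacobian
  conv_rhs => rw [h1]
  rw [← mul_assoc, ← C_mul]
  simp

theorem sectorAct_koszulD {W : MvPolynomial (Fin n) k} (hW : ∀ h, diagAction χ h W = W)
    (h g : H) (u : Theta (FixedRing χ h) (FixedIdx χ h)) :
    koszulD (jacobian χ W h) (sectorAct χ h g u) =
      sectorAct χ h g (koszulD (jacobian χ W h) u) := by
  funext J
  have e3 : ∀ v K, sectorAct χ h g v K = C (thetaWeight χ g (movedIdx χ h) *
    thetaWeight (fun i : FixedIdx χ h => χ i.val) g K : kˣ).val * fixedAction χ h g (v K) :=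
    fun v K => rfl
  have e4 : ∀ (i : FixedIdx χ h) (K : Finset (FixedIdx χ h)),
      fixedAction χ h g (thetaSign (FixedRing χ h) i K) = thetaSign (FixedRing χ h) i K := by
    intro i K; simp [thetaSign]
  rw [e3]
  simp only [koszulD, LinearMap.sum_apply, LinearMap.smul_apply, Finset.sum_apply, map_sum,
    Finset.mul_sum, Pi.smul_apply, smul_eq_mul, map_mul, fixedAction_jacobian χ hW]
  refine Finset.sum_congr rfl fun i _ => ?_
  by_cases hi : i ∈ J
  · simp [dTheta, hi]
  · simp only [dTheta, LinearMap.coe_mk, AddHom.coe_mk, hi, if_false, e3, map_mul, e4,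
      thetaWeight_insert (fun i : FixedIdx χ h => χ i.val) g hi, Units.val_mul]
    ring

theorem sectorAct_mem_koszulDeg (h g : H) {i : ℤ} {u : Theta (FixedRing χ h) (FixedIdx χ h)}
    (hu : u ∈ koszulDeg (FixedRing χ h) (FixedIdx χ h) i) :
    sectorAct χ h g u ∈ koszulDeg (FixedRing χ h) (FixedIdx χ h) i := by
  intro J hJ
  refine hu J fun h1 => hJ ?_
  change C _ * fixedAction χ h g (u J) = 0
  rw [h1]; simp

variable {χ} {W : MvPolynomial (Fin n) k}

/-- The action of `g` on the cocycles of `K^*(∂W^h) · θ_{I_h}`. -/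
def cocycleAct (hW : ∀ h, diagAction χ h W = W) (h g : H) (i : ℤ) :
    ↥(koszulCocycles (jacobian χ W h) i)
      →ₛₗ[(fixedAction χ h g : FixedRing χ h →+* FixedRing χ h)]
    ↥(koszulCocycles (jacobian χ W h) i) where
  toFun z := ⟨sectorAct χ h g z.1, by
    obtain ⟨z, hz1, hz2⟩ := z
    refine ⟨?_, sectorAct_mem_koszulDeg χ h g hz2⟩
    change koszulD _ (sectorAct χ h g z) = 0
    rw [sectorAct_koszulD χ hW, LinearMap.mem_ker.mp hz1, map_zero]⟩
  map_add' z z' := by ext1; simp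
  map_smul' a z := by
    apply Subtype.ext
    exact (sectorAct χ h g).map_smulₛₗ a z.1

/-- The action of `g` on the cohomology `H^i(K^*(∂W^h)) · θ_{I_h}`. -/
def cohomologyAct (hW : ∀ h, diagAction χ h W = W) (h g : H) (i : ℤ) :
    koszulCohomology (jacobian χ W h) i
      →ₛₗ[(fixedAction χ h g : FixedRing χ h →+* FixedRing χ h)]
    koszulCohomology (jacobian χ W h) i :=
  Submodule.mapQ _ _ (cocycleAct hW h g i) (by
    rintro z ⟨y, hy, hyz⟩
    refine ⟨sectorAct χ h g y, sectorAct_mem_koszulDeg χ h g hy, ?_⟩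
    rw [sectorAct_koszulD χ hW, hyz]
    rfl)

variable (χ W)

/-- `H^i(K^*(∂W^h)) · θ_{I_h}` as a module over `S`, on which `x_i` and `x_i'` act as `x_i^h`. -/
def Sector (h : H) (i : ℤ) : Type u := koszulCohomology (jacobian χ W h) i

instance (h : H) (i : ℤ) : AddCommGroup (Sector χ W h i) :=
  inferInstanceAs (AddCommGroup (koszulCohomology (jacobian χ W h) i))

instance (h : H) (i : ℤ) : Module (DoubleRing k n) (Sector χ W h i) :=
  Module.compHom (koszulCohomology (jacobian χ W h) i) (restrictS χ h).toRingHom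

variable {χ W}

/-- The action of `g` on `H^i(K^*(∂W^h)) · θ_{I_h}`, as an additive map. -/
def sectorCohomologyAct (hW : ∀ h, diagAction χ h W = W) (h g : H) (i : ℤ) :
    Sector χ W h i →+ Sector χ W h i :=
  (cohomologyAct hW h g i).toAddMonoidHom

theorem sectorCohomologyAct_smul (hW : ∀ h, diagAction χ h W = W) (h g : H) (i : ℤ)
    (s : DoubleRing k n) (c : Sector χ W h i) :
    sectorCohomologyAct hW h g i (s • c) =
      doubleAction χ (g, g) s • sectorCohomologyAct hW h g i c := by
  refine ((cohomologyAct hW h g i).map_smulₛₗ (restrictS χ h s) c).trans ?_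
  change fixedAction χ h g (restrictS χ h s) • _ = _
  rw [fixedAction_restrictS]
  rfl

variable (χ W)

/-- The pairs `(h, i)` for which `H^i(K^*(∂W^h)) · θ_{I_h}` lies in degree `j` modulo 2; since
`|θ_j| = -1`, its degree is `i - |I_h|`. -/
abbrev SectorIdx (j : ZMod 2) : Type v :=
  {p : H × ℤ // ((p.2 - ((movedIdx χ p.1).card : ℤ) : ℤ) : ZMod 2) = j}

/-- The degree `j` part of `⨁_h H^*(K^*(∂W^h)) · θ_{I_h}`. -/
abbrev SectorSum (j : ZMod 2) : Type (max u v) :=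
  DirectSum (SectorIdx χ j) fun p => Sector χ W p.val.1 p.val.2

variable {χ W}

/-- The degree `j` part of the orbifold Koszul cohomology
`Kos(W, H) = (⨁_h H^*(K^*(∂W^h)) · θ_{I_h})^H`, a module over `S^{H × H}`. -/
def Kos (hW : ∀ h, diagAction χ h W = W) (j : ZMod 2) :
    Submodule (invariants (doubleAction (k := k) χ)) (SectorSum χ W j) where
  carrier := {c | ∀ (g : H) (p : SectorIdx χ j),
    sectorCohomologyAct hW p.val.1 g p.val.2 (c p) = c p}
  zero_mem' := fun g p => by simp
  add_mem' := fun {c c'} hc hc' g p => by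
    rw [DirectSum.add_apply, map_add, hc g p, hc' g p]
  smul_mem' := by
    rintro ⟨s, hs⟩ c hc g p
    change sectorCohomologyAct hW p.val.1 g p.val.2 (s • c p) = s • c p
    rw [sectorCohomologyAct_smul, hs, hc g p]

end Sector

end OrbifoldLG

end

/-! The group `H × H` permutes the summands `Δ_W^h` transitively, and the stabilizer of `Δ_W^1` is
the diagonal copy of `H`. An equivariant endomorphism is therefore the same as a family of
components `Δ_W^1 → Δ_W^h`, one for each `h`, each invariant under the diagonal (`ext_of_toMat`,
`ofMat_diagAct`). A component is a matrix `M (J, L)`, the coefficient of `θ_J` in the image of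
`θ_L`.

On these matrices the differential is of Koszul type, with `2n` pairs of coefficients. One half of
each pair is `x_i' - h_i x_i` (for `i ∈ J`) or `x_i' - x_i` (for `i ∉ L`); the other half is a twist
of `∇_i W`. The elements `x_i' - h_i x_i` for all `i`, together with `x_i' - x_i` for `i ∈ I_h`,
form a regular sequence with quotient `k[x_i : i ∈ I^h]`. Regular elements can be eliminated one at
a time (`ToggleSystem.Exact.insert`), so the projection to the entries with `J = {1, …, n}` and `L ⊆
I^h`, restricted to the fixed locus of `h`, has acyclic kernel (`exact_homOp`). In the image only
the coefficients `∇_i W` with `i ∈ I^h` survive, and they restrict to `∂_i W^h` (`restrictS_nabla`).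
With `K = I^h \ L` this is the Koszul complex (`koszulProj_homOp`).

The factor `θ_{I_h}` records the remaining parity and weight: an entry in position `({1, …, n}, L)`
transforms like `θ_K θ_{I_h}` (`parity_fixedCompl`, `thetaWeight_univ`).

Taking `H`-invariants commutes with cohomology by averaging, even if the characteristic of `k`
divides the order of `H`: the action on matrices factors through the image of `H` in `(k^*)^n`, and
a finite subgroup there has order invertible in `k` (`natCast_card_ne_zero_of_subgroup_units`). -/

noncomputable section

namespace OrbifoldLG

universe u v

/-! ### Clifford operators in terms of toggling one index -/

section Toggle

variable {A : Type*} [CommRing A] {ι : Type*} [LinearOrder ι]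

/-- The set `J` with the membership of `i` reversed. -/
def toggle (i : ι) (J : Finset ι) : Finset ι := if i ∈ J then J.erase i else insert i J

theorem mem_toggle_self (i : ι) (J : Finset ι) : i ∈ toggle i J ↔ i ∉ J := by
  by_cases h : i ∈ J <;> simp [toggle, h]

theorem mem_toggle_of_ne {i e : ι} (h : e ≠ i) (J : Finset ι) : e ∈ toggle i J ↔ e ∈ J := by
  by_cases hi : i ∈ J <;> simp [toggle, hi, h]

theorem toggle_toggle (i : ι) (J : Finset ι) : toggle i (toggle i J) = J := by
  by_cases h : i ∈ J <;> simp [toggle, h]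

theorem card_toggle (i : ι) (J : Finset ι) : ((toggle i J).card : ZMod 2) = J.card + 1 := by
  by_cases h : i ∈ J
  · rw [toggle, if_pos h, ← Finset.card_erase_add_one h]
    push_cast
    rw [add_assoc, show (1 + 1 : ZMod 2) = 0 from rfl, add_zero]
  · rw [toggle, if_neg h, Finset.card_insert_of_notMem h]
    push_cast; rfl

/-- At a given `J` only one of `θ_i` and `∂_{θ_i}` contributes. Both read the entry at the toggled
set with the same sign, so they merge into one term. -/
theorem cliffordOp_eq_sum_toggle [Fintype ι] (a b : ι → A) (u : Theta A ι) (J : Finset ι) :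
    cliffordOp a b u J =
      ∑ i, thetaSign A i J * (if i ∈ J then a i else b i) * u (toggle i J) := by
  rw [cliffordOp_apply, Finset.sum_apply]
  refine Finset.sum_congr rfl fun i _ => ?_
  by_cases h : i ∈ J <;> simp [theta, dTheta, toggle, h] <;> ring

end Toggle

/-! ### Elimination of regular elements -/

/-- A set `X` with a family of membership predicates that can be reversed one at a time. -/
structure ToggleSystem (ι X : Type*) where
  mem : ι → X → Prop
  flip : ι → X → X
  flip_flip : ∀ i x, flip i (flip i x) = x
  mem_flip_self : ∀ i x, mem i (flip i x) ↔ ¬ mem i x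
  mem_flip_of_ne : ∀ i e x, e ≠ i → (mem e (flip i x) ↔ mem e x)

namespace ToggleSystem

variable {A : Type*} [CommRing A] {ι X : Type*} [Fintype ι] (T : ToggleSystem ι X)

open Classical in
/-- The operator `∑_i (a_i θ_i + b_i ∂_{θ_i})` on functions on `X`, with the signs `ε`. -/
def op (ε : ι → X → A) (a b : ι → A) (u : X → A) (x : X) : A :=
  ∑ i, ε i x * (if T.mem i x then a i else b i) * u (T.flip i x)

/-- The functions on `X` whose values at the points in all the sets of `E` lie in the ideal
generated by the `a_e`, `e ∈ E`. -/
def vanishing (a : ι → A) (E : Finset ι) : AddSubgroup (X → A) where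
  carrier := {u | ∀ x, (∀ e ∈ E, T.mem e x) → u x ∈ Ideal.span (a '' E)}
  zero_mem' _ _ := zero_mem _
  add_mem' hu hv x hx := add_mem (hu x hx) (hv x hx)
  neg_mem' hu x hx := neg_mem (hu x hx)

/-- The complex given by the two operators `op ε' a b` and `op ε a b` is exact on
`T.vanishing a E`. -/
def Exact (ε ε' : ι → X → A) (a b : ι → A) (E : Finset ι) : Prop :=
  ∀ u ∈ T.vanishing a E, T.op ε a b u = 0 → ∃ w ∈ T.vanishing a E, T.op ε' a b w = u

theorem op_sub (ε : ι → X → A) (a b : ι → A) (u v : X → A) :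
    T.op ε a b (u - v) = T.op ε a b u - T.op ε a b v := by
  funext x
  simp [op, mul_sub]

theorem op_add (ε : ι → X → A) (a b : ι → A) (u v : X → A) :
    T.op ε a b (u + v) = T.op ε a b u + T.op ε a b v := by
  funext x
  simp [op, mul_add, Finset.sum_add_distrib]

/-- For `E = ∅` the condition applies at every point and the ideal is zero, so only `u = 0` is
allowed. This starts the induction on `E`. -/
theorem exact_empty (ε ε' : ι → X → A) (a b : ι → A) : T.Exact ε ε' a b ∅ := by
  intro u hu _
  refine ⟨0, zero_mem _, ?_⟩
  funext x
  have := hu x (by simp)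
  simp only [Finset.coe_empty, Set.image_empty, Ideal.span_empty, Ideal.mem_bot] at this
  simp [op, this]

variable [DecidableEq ι]

omit [Fintype ι] in
theorem vanishing_insert_le (a : ι → A) (E : Finset ι) (e : ι) :
    T.vanishing a E ≤ T.vanishing a (insert e E) := by
  intro u hu x hx
  refine Ideal.span_mono ?_ (hu x fun e' he' => hx e' (Finset.mem_insert_of_mem he'))
  exact Set.image_mono (by simp)

/-- One elimination step. A closed `u` is changed by a boundary until it vanishes modulo the smaller
ideal at the points lying in all sets of `E ∪ {e}`. Closedness and regularity of `a e` modulo `(a_i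
: i ∈ E)` then force the same at the points of `E` outside `e`, so exactness for `E` applies. -/
theorem Exact.insert {ε ε' : ι → X → A} {a b : ι → A} {E : Finset ι} {e : ι}
    (hE : T.Exact ε ε' a b E) (he : e ∉ E) (hε : ∀ i x, ε i x * ε i x = 1)
    (hε' : ∀ i x, ε' i x * ε' i x = 1)
    (hreg : ∀ s, a e * s ∈ Ideal.span (a '' E) → s ∈ Ideal.span (a '' E))
    (hop : ∀ u, T.op ε a b (T.op ε' a b u) = 0) : T.Exact ε ε' a b (insert e E) := by
  classical
  intro u hu hu0
  have hspan : ∀ x, (∀ e' ∈ Insert.insert e E, T.mem e' x) →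
      ∃ c, u x - a e * c ∈ Ideal.span (a '' E) := by
    intro x hx
    have h := hu x hx
    rw [Finset.coe_insert, Set.image_insert_eq, Ideal.span_insert, Submodule.mem_sup] at h
    obtain ⟨y, hy, z, hz, h⟩ := h
    obtain ⟨c, rfl⟩ := Ideal.mem_span_singleton.mp hy
    exact ⟨c, by rw [← h]; simpa using hz⟩
  choose! c hc using hspan
  -- `w` vanishes at all points that contain `e`. Hence at a point of `E ∪ {e}` only the `e`-term of
  -- its differential survives, and the sign is chosen to make that term `a e * c x`.
  let w : X → A := fun x => if T.mem e x then 0 else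
    if ∀ e' ∈ E, T.mem e' x then ε' e (T.flip e x) * c (T.flip e x) else 0
  have hw : w ∈ T.vanishing a (Insert.insert e E) := by
    intro x hx
    simp [w, hx e (Finset.mem_insert_self e E)]
  have hEflip : ∀ x, (∀ e' ∈ E, T.mem e' (T.flip e x)) ↔ ∀ e' ∈ E, T.mem e' x := by
    intro x
    refine forall₂_congr fun e' he' => T.mem_flip_of_ne e e' x ?_
    rintro rfl; exact he he'
  have hDw : ∀ x, (∀ e' ∈ Insert.insert e E, T.mem e' x) → T.op ε' a b w x = a e * c x := by
    intro x hx
    have hxe : T.mem e x := hx e (Finset.mem_insert_self e E)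
    rw [op, Finset.sum_eq_single e]
    · have h1 : ∀ e' ∈ E, T.mem e' (T.flip e x) :=
        (hEflip x).2 fun e' he' => hx e' (Finset.mem_insert_of_mem he')
      have h2 : ¬ T.mem e (T.flip e x) := by rw [T.mem_flip_self]; exact not_not.2 hxe
      simp only [w, if_pos hxe, if_neg h2, if_pos h1, T.flip_flip]
      calc _ = ε' e x * ε' e x * (a e * c x) := by ring
        _ = _ := by rw [hε', one_mul]
    · intro i _ hi
      have : T.mem e (T.flip i x) := (T.mem_flip_of_ne i e x hi.symm).2 hxe
      simp [w, this]
    · simp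
  have hv : u - T.op ε' a b w ∈ T.vanishing a E := by
    have hv1 : ∀ x, (∀ e' ∈ Insert.insert e E, T.mem e' x) →
        (u - T.op ε' a b w) x ∈ Ideal.span (a '' E) := by
      intro x hx
      rw [Pi.sub_apply, hDw x hx]
      exact hc x hx
    intro x hx
    by_cases hxe : T.mem e x
    · exact hv1 x fun e' he' => by
        rcases Finset.mem_insert.1 he' with rfl | h
        exacts [hxe, hx _ h]
    have hy : ∀ e' ∈ Insert.insert e E, T.mem e' (T.flip e x) := by
      intro e' he'
      rcases Finset.mem_insert.1 he' with rfl | h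
      · exact (T.mem_flip_self _ x).2 hxe
      · exact (hEflip x).2 hx e' h
    -- The closedness equation is read at the flipped point, which lies in every set of `E ∪ {e}`.
    -- Its `e`-term is `a e` times the value at `x`, up to sign. The terms with `i ∈ E` carry the
    -- factor `a i`, and all the others are values at points of `E ∪ {e}`, handled by `hv1`.
    have h0 : T.op ε a b (u - T.op ε' a b w) (T.flip e x) = 0 := by
      rw [op_sub, hop, hu0]; simp
    rw [op, ← Finset.add_sum_erase _ _ (Finset.mem_univ e), T.flip_flip,
      if_pos (hy e (Finset.mem_insert_self e E))] at h0
    have h1 : ∑ i ∈ Finset.univ.erase e, ε i (T.flip e x) *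
        (if T.mem i (T.flip e x) then a i else b i) *
          (u - T.op ε' a b w) (T.flip i (T.flip e x)) ∈ Ideal.span (a '' E) := by
      refine sum_mem fun i hi => ?_
      have hie : i ≠ e := Finset.ne_of_mem_erase hi
      by_cases hiE : i ∈ E
      · rw [if_pos (hy i (Finset.mem_insert_of_mem hiE))]
        exact Ideal.mul_mem_right _ _ (Ideal.mul_mem_left _ _
          (Ideal.subset_span (Set.mem_image_of_mem a hiE)))
      · refine Ideal.mul_mem_left _ _ (hv1 _ fun e' he' => ?_)
        refine (T.mem_flip_of_ne i e' _ ?_).2 (hy e' he')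
        rintro rfl
        rcases Finset.mem_insert.1 he' with h | h
        exacts [hie h, hiE h]
    have h2 : a e * (u - T.op ε' a b w) x ∈ Ideal.span (a '' E) := by
      have : a e * (u - T.op ε' a b w) x = ε e (T.flip e x) *
          (ε e (T.flip e x) * a e * (u - T.op ε' a b w) x) := by
        calc _ = ε e (T.flip e x) * ε e (T.flip e x) * (a e * (u - T.op ε' a b w) x) := by
              rw [hε, one_mul]
          _ = _ := by ring
      rw [this, eq_neg_of_add_eq_zero_left h0]
      exact Ideal.mul_mem_left _ _ (neg_mem h1)
    exact hreg _ h2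
  obtain ⟨w', hw', h⟩ := hE _ hv (by rw [op_sub, hop, hu0, sub_zero])
  refine ⟨w + w', add_mem hw (T.vanishing_insert_le a E e hw'), ?_⟩
  rw [op_add, h]; abel

end ToggleSystem

/-! ### Operators on matrices indexed by the monomials `θ_J` -/

section Matrices

variable {A : Type*} [CommRing A] {ι : Type*}

/-- The matrices over `A` whose rows and columns are indexed by the monomials `θ_J`. -/
abbrev ThetaMatrix (A : Type*) (ι : Type*) : Type _ := Finset ι × Finset ι → A

/-- The action of an operator on the columns of a matrix. -/
def onColumns (f : Theta A ι →ₗ[A] Theta A ι) : ThetaMatrix A ι →ₗ[A] ThetaMatrix A ι where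
  toFun M x := f (fun J => M (J, x.2)) x.1
  map_add' M N := by
    funext x
    exact congrFun (map_add f (fun J => M (J, x.2)) (fun J => N (J, x.2))) x.1
  map_smul' a M := by
    funext x
    exact congrFun (map_smul f a (fun J => M (J, x.2))) x.1

/-- The action of an operator on the rows of a matrix. -/
def onRows (f : Theta A ι →ₗ[A] Theta A ι) : ThetaMatrix A ι →ₗ[A] ThetaMatrix A ι where
  toFun M x := f (fun L => M (x.1, L)) x.2
  map_add' M N := by
    funext x
    exact congrFun (map_add f (fun L => M (x.1, L)) (fun L => N (x.1, L))) x.2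
  map_smul' a M := by
    funext x
    exact congrFun (map_smul f a (fun L => M (x.1, L))) x.2

variable [LinearOrder ι] [Fintype ι]

theorem onColumns_cliffordOp_apply (a b : ι → A) (M : ThetaMatrix A ι) (J L : Finset ι) :
    onColumns (cliffordOp a b) M (J, L) =
      ∑ i, thetaSign A i J * (if i ∈ J then a i else b i) * M (toggle i J, L) :=
  cliffordOp_eq_sum_toggle a b _ J

theorem onRows_cliffordOp_apply (a b : ι → A) (M : ThetaMatrix A ι) (J L : Finset ι) :
    onRows (cliffordOp a b) M (J, L) =
      ∑ i, thetaSign A i L * (if i ∈ L then a i else b i) * M (J, toggle i L) :=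
  cliffordOp_eq_sum_toggle a b _ L

theorem onColumns_onRows_comm (a b a' b' : ι → A) (M : ThetaMatrix A ι) :
    onColumns (cliffordOp a b) (onRows (cliffordOp a' b') M) =
      onRows (cliffordOp a' b') (onColumns (cliffordOp a b) M) := by
  funext ⟨J, L⟩
  simp only [onColumns_cliffordOp_apply, onRows_cliffordOp_apply, Finset.mul_sum]
  rw [Finset.sum_comm]
  refine Finset.sum_congr rfl fun i _ => Finset.sum_congr rfl fun j _ => ?_
  ring

theorem onColumns_cliffordOp_sq (a b : ι → A) (M : ThetaMatrix A ι) :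
    onColumns (cliffordOp a b) (onColumns (cliffordOp a b) M) = (∑ i, a i * b i) • M := by
  funext ⟨J, L⟩
  exact congrFun (cliffordOp_sq a b fun J => M (J, L)) J

theorem onRows_cliffordOp_sq (a b : ι → A) (M : ThetaMatrix A ι) :
    onRows (cliffordOp a b) (onRows (cliffordOp a b) M) = (∑ i, a i * b i) • M := by
  funext ⟨J, L⟩
  exact congrFun (cliffordOp_sq a b fun L => M (J, L)) L

end Matrices

/-! ### The complex of morphisms from `Δ_W^1` to `Δ_W^h` -/

section Diagonal

variable {k : Type u} [Field k] {n : ℕ} {H : Type v} [CommGroup H] (χ : Fin n → H →* kˣ)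
variable {W : MvPolynomial (Fin n) k}

theorem sum_coeffTheta_mul_coeffDTheta (hW : ∀ h, diagAction χ h W = W) (h : H) :
    ∑ i, coeffTheta χ h i * coeffDTheta χ W h i = boxminus W := by
  have := congrArg (doubleAction χ (1, h)) (sum_nabla W)
  rw [doubleAction_boxminus hW, map_sum] at this
  rw [← this]
  refine Finset.sum_congr rfl fun i _ => ?_
  rw [map_mul]
  simp [coeffTheta, coeffDTheta, doubleAction]

variable (W)

/-- The operator `φ ↦ d φ - σ φ d` on the matrices of the linear maps `Δ_W^1 → Δ_W^h`. -/
def homOp (h : H) (σ : DoubleRing k n) :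
    ThetaMatrix (DoubleRing k n) (Fin n) →ₗ[DoubleRing k n]
      ThetaMatrix (DoubleRing k n) (Fin n) :=
  onColumns (cliffordOp (coeffTheta χ h) (coeffDTheta χ W h)) -
    σ • onRows (cliffordOp (coeffDTheta χ W 1) (coeffTheta χ 1))

variable {W}

/-- Both differentials square to `W ⊟ W`, so the composite is `(1 + σ τ) (W ⊟ W) M - (σ + τ) d M d`.
The signs of adjacent degrees make both terms vanish. -/
theorem homOp_homOp (hW : ∀ h, diagAction χ h W = W) (h : H) {σ τ : DoubleRing k n}
    (hστ : σ * τ = -1) (hs : σ + τ = 0) (M : ThetaMatrix (DoubleRing k n) (Fin n)) :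
    homOp χ W h σ (homOp χ W h τ M) = 0 := by
  have h1 := onColumns_cliffordOp_sq (coeffTheta χ h) (coeffDTheta χ W h) M
  have h2 := onRows_cliffordOp_sq (coeffDTheta χ W 1) (coeffTheta χ 1) M
  have h3 := onColumns_onRows_comm (coeffTheta χ h) (coeffDTheta χ W h)
    (coeffDTheta χ W 1) (coeffTheta χ 1) M
  rw [sum_coeffTheta_mul_coeffDTheta χ hW] at h1
  rw [Finset.sum_congr rfl fun i _ => mul_comm _ _, sum_coeffTheta_mul_coeffDTheta χ hW] at h2
  simp only [homOp, LinearMap.sub_apply, LinearMap.smul_apply, map_sub, map_smul, h1, h2, h3]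
  rw [smul_sub, smul_smul, mul_comm τ σ, hστ, eq_neg_of_add_eq_zero_left hs]
  module

variable (n) in
/-- The toggle system on pairs `(J, L)`: membership of `i` in `J` and in the complement of `L`. -/
def pairSystem : ToggleSystem (Fin n ⊕ Fin n) (Finset (Fin n) × Finset (Fin n)) where
  mem := Sum.elim (fun i x => i ∈ x.1) (fun i x => i ∉ x.2)
  flip := Sum.elim (fun i x => (toggle i x.1, x.2)) (fun i x => (x.1, toggle i x.2))
  flip_flip := by rintro (i | i) x <;> simp [toggle_toggle]
  mem_flip_self := by rintro (i | i) x <;> simp [mem_toggle_self]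
  mem_flip_of_ne := by
    rintro (i | i) (e | e) x h <;> simp
    · exact mem_toggle_of_ne (by simpa using h) _
    · exact not_congr (mem_toggle_of_ne (by simpa using h) _)

/-- The signs of the terms of `homOp`. -/
def homSign (σ : DoubleRing k n) :
    Fin n ⊕ Fin n → Finset (Fin n) × Finset (Fin n) → DoubleRing k n :=
  Sum.elim (fun i x => thetaSign _ i x.1) (fun i x => -σ * thetaSign _ i x.2)

theorem homSign_mul_self {σ : DoubleRing k n} (hσ : σ * σ = 1) (i x) :
    homSign σ i x * homSign σ i x = 1 := by
  rcases i with i | i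
  · simp only [homSign, Sum.elim_inl]
    rw [thetaSign_mul_self]
  · simp only [homSign, Sum.elim_inr]
    rw [mul_mul_mul_comm, neg_mul_neg, hσ, thetaSign_mul_self, one_mul]

/-- The coefficients of `homOp` that form the regular sequence. -/
def homCoeff (h : H) : Fin n ⊕ Fin n → DoubleRing k n :=
  Sum.elim (coeffTheta χ h) (coeffTheta χ 1)

variable (W) in
-- Precomposition transposes the operator and exchanges the roles of `θ_i` and `∂_{θ_i}`, so `x_i' -
-- x_i` appears when `i ∉ L`. This is why `pairSystem` uses the complement of `L`.
theorem homOp_eq_op (h : H) (σ : DoubleRing k n) (M : ThetaMatrix (DoubleRing k n) (Fin n)) :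
    homOp χ W h σ M = (pairSystem n).op (homSign σ) (homCoeff χ h)
      (Sum.elim (coeffDTheta χ W h) (coeffDTheta χ W 1)) M := by
  funext ⟨J, L⟩
  rw [ToggleSystem.op, Fintype.sum_sum_type, homOp, LinearMap.sub_apply, LinearMap.smul_apply,
    Pi.sub_apply, Pi.smul_apply, onColumns_cliffordOp_apply, onRows_cliffordOp_apply,
    sub_eq_add_neg, smul_eq_mul, ← neg_mul, Finset.mul_sum]
  refine congrArg₂ (· + ·) (Finset.sum_congr rfl fun i _ => ?_)
    (Finset.sum_congr rfl fun i _ => ?_)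
  · by_cases h : i ∈ J <;> simp [pairSystem, homSign, homCoeff, h]
  · by_cases h : i ∈ L <;> simp [pairSystem, homSign, homCoeff, h, mul_assoc]

/-! ### The regular sequence -/

/-- Modulo `I` the composite `g ∘ f` is the identity on the variables, hence everywhere, so `f p =
0` forces `p ∈ I`. -/
theorem ker_le_of_X_sub_mem {R σ B : Type*} [CommRing R] [CommRing B] [Algebra R B]
    (f : MvPolynomial σ R →ₐ[R] B) (g : B →ₐ[R] MvPolynomial σ R) (I : Ideal (MvPolynomial σ R))
    (h : ∀ i, X i - g (f (X i)) ∈ I) : RingHom.ker f ≤ I := by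
  intro p hp
  have h1 : (Ideal.Quotient.mkₐ R I).comp (g.comp f) = Ideal.Quotient.mkₐ R I := by
    ext i
    exact ((Ideal.Quotient.eq).2 (h i)).symm
  have h2 := congrArg (fun q => q p) h1
  simp only [AlgHom.comp_apply, RingHom.mem_ker.1 hp, map_zero] at h2
  exact Ideal.Quotient.eq_zero_iff_mem.1 h2.symm

open Classical in
/-- The substitution that makes `x_i' - h_i x_i`, `i ∈ T`, and `x_i`, `i ∈ T'`, vanish. -/
def stageSubst (h : H) (T T' : Finset (Fin n)) : DoubleRing k n →ₐ[k] DoubleRing k n :=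
  aeval (Sum.elim (fun i => if i ∈ T' then 0 else X (Sum.inl i))
    (fun i => if i ∈ T then C (χ i h : k) * (if i ∈ T' then 0 else X (Sum.inl i))
      else X (Sum.inr i)))

/-- The two coefficients differ by `(1 - h_i) x_i`, and `1 - h_i` is a nonzero scalar when `h` moves
`x_i`. -/
theorem X_inl_mem {h : H} {i : Fin n} (hi : χ i h ≠ 1) {I : Ideal (DoubleRing k n)}
    (h1 : coeffTheta χ h i ∈ I) (h2 : coeffTheta χ 1 i ∈ I) : X (Sum.inl i) ∈ I := by
  have h3 : (1 - (χ i h : k)) ≠ 0 := by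
    rw [sub_ne_zero]
    exact fun e => hi (Units.ext e.symm)
  have h4 : (X (Sum.inl i) : DoubleRing k n) =
      C (1 - (χ i h : k))⁻¹ * (coeffTheta χ h i - coeffTheta χ 1 i) := by
    have : coeffTheta χ h i - coeffTheta χ 1 i = C (1 - (χ i h : k)) * X (Sum.inl i) := by
      simp only [coeffTheta, map_sub, map_one, Units.val_one]; ring
    rw [this, ← mul_assoc, ← C_mul, inv_mul_cancel₀ h3, C_1, one_mul]
  rw [h4]
  exact Ideal.mul_mem_left _ _ (sub_mem h1 h2)

theorem mem_movedIdx {h : H} {i : Fin n} : i ∈ movedIdx χ h ↔ χ i h ≠ 1 := by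
  classical
  simp [movedIdx]

/-- Each partial ideal of the sequence is the kernel of a homomorphism into a domain, hence prime.
Regularity of the next element then only requires that its image be nonzero. -/
theorem ker_stageSubst (h : H) {T T' : Finset (Fin n)} (hT : T' ⊆ T) (hm : T' ⊆ movedIdx χ h) :
    RingHom.ker (stageSubst χ h T T') = Ideal.span (homCoeff χ h '' (T.disjSum T')) := by
  classical
  apply le_antisymm
  · have hl : ∀ i ∈ T, coeffTheta χ h i ∈ Ideal.span (homCoeff χ h '' (T.disjSum T')) :=
      fun i hi => Ideal.subset_span ⟨Sum.inl i, by simpa using hi, rfl⟩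
    have hr : ∀ i ∈ T', coeffTheta χ 1 i ∈ Ideal.span (homCoeff χ h '' (T.disjSum T')) :=
      fun i hi => Ideal.subset_span ⟨Sum.inr i, by simpa using hi, rfl⟩
    have hx : ∀ i ∈ T', X (Sum.inl i) ∈ Ideal.span (homCoeff χ h '' (T.disjSum T')) :=
      fun i hi => X_inl_mem χ ((mem_movedIdx χ).1 (hm hi)) (hl i (hT hi)) (hr i hi)
    refine ker_le_of_X_sub_mem _ (AlgHom.id k _) _ ?_
    rintro (i | i)
    · by_cases hi : i ∈ T'
      · simpa [stageSubst, hi] using hx i hi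
      · simp [stageSubst, hi]
    · by_cases hi : i ∈ T
      · by_cases hi' : i ∈ T'
        · have : (X (Sum.inr i) : DoubleRing k n) =
            coeffTheta χ h i + C (χ i h : k) * X (Sum.inl i) := by simp [coeffTheta]
          simp only [stageSubst, aeval_X, Sum.elim_inr, hi, hi', if_true, mul_zero, map_zero,
            sub_zero]
          rw [this]
          exact add_mem (hl i hi) (Ideal.mul_mem_left _ _ (hx i hi'))
        · simpa [stageSubst, hi, hi', coeffTheta] using hl i hi
      · simp [stageSubst, hi]
  · rw [Ideal.span_le]
    rintro _ ⟨i | i, hi, rfl⟩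
    · have hi : i ∈ T := by simpa using hi
      simp [stageSubst, homCoeff, coeffTheta, RingHom.mem_ker, hi, algebraMap_eq]
    · have hi : i ∈ T' := by simpa using hi
      simp [stageSubst, homCoeff, coeffTheta, RingHom.mem_ker, hi, hT hi]

theorem mem_span_of_mul_mem (h : H) {T T' : Finset (Fin n)} (hT : T' ⊆ T)
    (hm : T' ⊆ movedIdx χ h) {s t : DoubleRing k n} (ht : stageSubst χ h T T' t ≠ 0)
    (hts : t * s ∈ Ideal.span (homCoeff χ h '' (T.disjSum T'))) :
    s ∈ Ideal.span (homCoeff χ h '' (T.disjSum T')) := by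
  rw [← ker_stageSubst χ h hT hm, RingHom.mem_ker, map_mul] at *
  exact (mul_eq_zero.1 hts).resolve_left ht

/-- The elements are eliminated in two rounds: `x_i' - h_i x_i` for all `i`, and then `x_i' - x_i`
for `i ∈ I_h`, which has become `(h_i - 1) x_i`. For `i ∈ I^h` the latter would already be zero. -/
theorem exact_homOp (hW : ∀ h, diagAction χ h W = W) (h : H) {σ τ : DoubleRing k n}
    (hσ : σ * σ = 1) (hs : σ + τ = 0) :
    (pairSystem n).Exact (homSign σ) (homSign τ) (homCoeff χ h)
      (Sum.elim (coeffDTheta χ W h) (coeffDTheta χ W 1))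
      (Finset.univ.disjSum (movedIdx χ h)) := by
  classical
  obtain rfl : τ = -σ := (neg_eq_of_add_eq_zero_right hs).symm
  have hop : ∀ M, (pairSystem n).op (homSign σ) (homCoeff χ h)
      (Sum.elim (coeffDTheta χ W h) (coeffDTheta χ W 1))
      ((pairSystem n).op (homSign (-σ)) (homCoeff χ h)
      (Sum.elim (coeffDTheta χ W h) (coeffDTheta χ W 1)) M) = 0 := by
    intro M
    rw [← homOp_eq_op, ← homOp_eq_op, homOp_homOp χ hW h (by rw [mul_neg, hσ]) (by simp)]
  have step : ∀ {E : Finset (Fin n ⊕ Fin n)} {e}, (pairSystem n).Exact (homSign σ) (homSign (-σ))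
      (homCoeff χ h) (Sum.elim (coeffDTheta χ W h) (coeffDTheta χ W 1)) E → e ∉ E →
      (∀ s, homCoeff χ h e * s ∈ Ideal.span (homCoeff χ h '' E) →
        s ∈ Ideal.span (homCoeff χ h '' E)) →
      (pairSystem n).Exact (homSign σ) (homSign (-σ)) (homCoeff χ h)
        (Sum.elim (coeffDTheta χ W h) (coeffDTheta χ W 1)) (insert e E) :=
    fun hE he hreg => hE.insert _ he (homSign_mul_self hσ)
      (homSign_mul_self (by rw [neg_mul_neg, hσ])) hreg hop
  have key1 : ∀ T : Finset (Fin n), (pairSystem n).Exact (homSign σ) (homSign (-σ))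
      (homCoeff χ h) (Sum.elim (coeffDTheta χ W h) (coeffDTheta χ W 1))
      (T.disjSum ∅) := by
    intro T
    induction T using Finset.induction_on with
    | empty => exact (pairSystem n).exact_empty _ _ _ _
    | insert i T hi ih =>
      have : (insert i T).disjSum (∅ : Finset (Fin n)) = insert (Sum.inl i) (T.disjSum ∅) := by
        ext (j | j) <;> simp
      rw [this]
      refine step ih (by simpa using hi) fun s hs => ?_
      refine mem_span_of_mul_mem χ h (Finset.empty_subset _) (Finset.empty_subset _) ?_ hs
      have : stageSubst χ h T ∅ (homCoeff χ h (Sum.inl i)) = coeffTheta χ h i := by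
        simp [stageSubst, homCoeff, coeffTheta, hi, algebraMap_eq]
      rw [this, coeffTheta]
      intro h0
      -- At `x = 0`, `x' = 1` the coefficient takes the value `1`.
      have := congrArg (aeval (Sum.elim (fun _ => (0 : k)) (fun _ => 1))) h0
      simp at this
  have key2 : ∀ T' ⊆ movedIdx χ h, (pairSystem n).Exact (homSign σ) (homSign (-σ))
      (homCoeff χ h) (Sum.elim (coeffDTheta χ W h) (coeffDTheta χ W 1))
      (Finset.univ.disjSum T') := by
    intro T'
    induction T' using Finset.induction_on with
    | empty => exact fun _ => key1 _
    | insert i T hi ih =>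
      intro hiT
      have hiT' := Finset.insert_subset_iff.1 hiT
      have : (Finset.univ.disjSum (insert i T) : Finset (Fin n ⊕ Fin n)) =
          insert (Sum.inr i) (Finset.univ.disjSum T) := by
        ext (j | j) <;> simp
      rw [this]
      refine step (ih hiT'.2) (by simpa using hi) fun s hs => ?_
      refine mem_span_of_mul_mem χ h (Finset.subset_univ _) hiT'.2 ?_ hs
      have : stageSubst χ h Finset.univ T (homCoeff χ h (Sum.inr i)) =
          C (χ i h - 1 : k) * X (Sum.inl i) := by
        simp [stageSubst, homCoeff, coeffTheta, hi, sub_mul]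
      rw [this]
      refine mul_ne_zero ?_ (X_ne_zero _)
      rw [Ne, C_eq_zero, sub_eq_zero]
      exact fun e => (mem_movedIdx χ).1 hiT'.1 (Units.ext e)
  exact key2 _ subset_rfl

end Diagonal

section Sector

variable {k : Type u} [Field k] {n : ℕ} {H : Type v} [CommGroup H] (χ : Fin n → H →* kˣ)

/-! ### Restriction to the fixed locus -/

theorem restrictS_mixedSubst (h : H) (p : MvPolynomial (Fin n) k) (m : ℕ) :
    restrictS χ h (mixedSubst p m) = restrictW χ p h := by
  unfold restrictS mixedSubst restrictW
  rw [← AlgHom.comp_apply]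
  congr 1
  ext1 j
  by_cases hj : j.val < m <;> simp [hj]

theorem mixedSubst_X (j : Fin n) (m : ℕ) :
    mixedSubst (X j : MvPolynomial (Fin n) k) m =
      if j.val < m then X (Sum.inr j) else X (Sum.inl j) := by
  simp [mixedSubst]

/-- Indices start at `0`, so `m ≤ i` says that `x_i` has not yet been replaced by `x_i'`. -/
theorem pderiv_mixedSubst_of_le {i : Fin n} {m : ℕ} (hm : m ≤ i.val)
    (p : MvPolynomial (Fin n) k) : pderiv (Sum.inr i) (mixedSubst p m) = 0 := by
  induction p using MvPolynomial.induction_on with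
  | C a => simp [mixedSubst, algebraMap_eq]
  | add p q hp hq => rw [mixedSubst, map_add, map_add]; exact (congrArg₂ _ hp hq).trans (add_zero 0)
  | mul_X p j hp =>
    have h1 : mixedSubst (p * X j) m = mixedSubst p m * mixedSubst (X j) m := map_mul _ _ _
    rw [h1, Derivation.leibniz, hp, mixedSubst_X]
    split_ifs with hj
    · rw [pderiv_X_of_ne]
      · simp
      · rintro e
        obtain rfl := Sum.inr_injective e
        omega
    · rw [pderiv_X_of_ne (by simp)]; simp

/-- For `i < m` only `x_i'`, and not `x_i`, occurs in the mixed substitution. Differentiating in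
`x_i'` and restricting therefore amounts to restricting first and differentiating in `x_i`. -/
theorem restrictS_pderiv_mixedSubst {h : H} {i : Fin n} (hi : χ i h = 1) {m : ℕ} (hm : i.val < m)
    (p : MvPolynomial (Fin n) k) :
    restrictS χ h (pderiv (Sum.inr i) (mixedSubst p m)) =
      pderiv (⟨i, hi⟩ : FixedIdx χ h) (restrictW χ p h) := by
  induction p using MvPolynomial.induction_on with
  | C a => simp [mixedSubst, restrictW, algebraMap_eq]
  | add p q hp hq =>
    have h1 : mixedSubst (p + q) m = mixedSubst p m + mixedSubst q m := map_add _ _ _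
    have h2 : restrictW χ (p + q) h = restrictW χ p h + restrictW χ q h := map_add _ _ _
    rw [h1, h2, map_add, map_add, map_add, hp, hq]
  | mul_X p j hp =>
    have h1 : mixedSubst (p * X j) m = mixedSubst p m * mixedSubst (X j) m := map_mul _ _ _
    have h2 : restrictW χ (p * X j) h = restrictW χ p h * restrictW χ (X j) h := map_mul _ _ _
    rw [h1, h2, Derivation.leibniz, Derivation.leibniz, map_add, smul_eq_mul, smul_eq_mul,
      smul_eq_mul, smul_eq_mul, map_mul, map_mul, hp, restrictS_mixedSubst, restrictS_mixedSubst]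
    congr 2
    have h3 : restrictW χ (X j) h = fixedVar χ h j := aeval_X _ _
    rw [mixedSubst_X, h3]
    by_cases hji : j = i
    · subst hji
      simp [hm, fixedVar, hi]
    · have hX : pderiv (⟨i, hi⟩ : FixedIdx χ h) (fixedVar χ h j) = 0 := by
        rw [fixedVar]
        split_ifs with hj
        · exact pderiv_X_of_ne fun e => hji (congrArg Subtype.val e)
        · exact map_zero _
      rw [hX]
      split_ifs
      · rw [pderiv_X_of_ne fun e => hji (Sum.inr_injective e), map_zero]
      · rw [pderiv_X_of_ne (by simp), map_zero]

/-- Apply `∂/∂x_i'` to the defining equation of `∇_i W` and restrict. The product rule leaves `∇_i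
W` alone, because `x_i' - x_i` restricts to zero, and only the first mixed substitution involves
`x_i'`. -/
theorem restrictS_nabla {h : H} {i : Fin n} (hi : χ i h = 1) (W : MvPolynomial (Fin n) k) :
    restrictS χ h (nabla W i) = jacobian χ W h ⟨i, hi⟩ := by
  have h1 := congrArg (fun p => restrictS χ h (pderiv (Sum.inr i) p)) (nabla_spec W i)
  simp only [map_sub, Derivation.leibniz, pderiv_mixedSubst_of_le le_rfl, sub_zero,
    restrictS_pderiv_mixedSubst χ hi (Nat.lt_succ_self _), smul_eq_mul, map_add, map_mul,
    pderiv_X_self, map_one] at h1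
  rw [jacobian, h1]
  simp [restrictS]

theorem restrictS_coeffDTheta_one {h : H} {i : Fin n} (hi : χ i h = 1)
    (W : MvPolynomial (Fin n) k) :
    restrictS χ h (coeffDTheta χ W 1 i) = jacobian χ W h ⟨i, hi⟩ := by
  rw [← restrictS_nabla χ hi, coeffDTheta, ← Prod.one_eq_mk, map_one]
  rfl

theorem restrictS_coeffTheta_self (h : H) (i : Fin n) : restrictS χ h (coeffTheta χ h i) = 0 := by
  by_cases hi : χ i h = 1 <;> simp [restrictS, coeffTheta, fixedVar, hi]

theorem restrictS_coeffTheta_one (h : H) (i : Fin n) : restrictS χ h (coeffTheta χ 1 i) = 0 := by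
  simp [restrictS, coeffTheta]

/-- The section of `restrictS` that sends `x_i` to `x_i`. -/
def restrictSection (h : H) : FixedRing χ h →ₐ[k] DoubleRing k n :=
  rename fun i => Sum.inl i.val

theorem restrictS_restrictSection (h : H) (p : FixedRing χ h) :
    restrictS χ h (restrictSection χ h p) = p := by
  have : (restrictS χ h).comp (restrictSection χ h) = AlgHom.id k _ := by
    ext1 i
    simp [restrictS, restrictSection, fixedVar, i.2]
  exact congrArg (fun f => f p) this

/-- This identifies the ideal of the full regular sequence with the ideal of the fixed locus of `h`,
embedded diagonally. -/
theorem ker_restrictS (h : H) :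
    RingHom.ker (restrictS χ h) =
      Ideal.span (homCoeff χ h '' ↑(Finset.univ.disjSum (movedIdx χ h) : Finset (Fin n ⊕ Fin n))) := by
  apply le_antisymm
  · have hl : ∀ i, coeffTheta χ h i ∈
        Ideal.span (homCoeff χ h '' ↑(Finset.univ.disjSum (movedIdx χ h) : Finset (Fin n ⊕ Fin n))) :=
      fun i => Ideal.subset_span ⟨Sum.inl i, by simp, rfl⟩
    have hr : ∀ i ∈ movedIdx χ h, coeffTheta χ 1 i ∈
        Ideal.span (homCoeff χ h '' ↑(Finset.univ.disjSum (movedIdx χ h) : Finset (Fin n ⊕ Fin n))) :=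
      fun i hi => Ideal.subset_span ⟨Sum.inr i, by simpa using hi, rfl⟩
    have hx : ∀ i ∈ movedIdx χ h, X (Sum.inl i) ∈
        Ideal.span (homCoeff χ h '' ↑(Finset.univ.disjSum (movedIdx χ h) : Finset (Fin n ⊕ Fin n))) :=
      fun i hi => X_inl_mem χ ((mem_movedIdx χ).1 hi) (hl i) (hr i hi)
    refine ker_le_of_X_sub_mem _ (restrictSection χ h) _ ?_
    rintro (i | i)
    · by_cases hi : χ i h = 1
      · simp [restrictS, restrictSection, fixedVar, hi]
      · simpa [restrictS, restrictSection, fixedVar, hi] using hx i ((mem_movedIdx χ).2 hi)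
    · by_cases hi : χ i h = 1
      · simpa [restrictS, restrictSection, fixedVar, hi, coeffTheta] using hl i
      · have : (X (Sum.inr i) : DoubleRing k n) =
          coeffTheta χ h i + C (χ i h : k) * X (Sum.inl i) := by simp [coeffTheta]
        simp only [restrictS, restrictSection, fixedVar, hi, aeval_X, Sum.elim_inr, dite_false,
          map_zero, sub_zero]
        rw [this]
        exact add_mem (hl i) (Ideal.mul_mem_left _ _ (hx i ((mem_movedIdx χ).2 hi)))
  · rw [Ideal.span_le]
    rintro _ ⟨i | i, -, rfl⟩
    exacts [restrictS_coeffTheta_self χ h i, restrictS_coeffTheta_one χ h i]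

/-! ### The projection to the Koszul complex -/

/-- The complement in `I^h` of a set of indices, as a subset of `{1, …, n}`. -/
def fixedCompl (h : H) (K : Finset (FixedIdx χ h)) : Finset (Fin n) :=
  Kᶜ.map (Function.Embedding.subtype _)

theorem mem_fixedCompl {h : H} {K : Finset (FixedIdx χ h)} {i : Fin n} :
    i ∈ fixedCompl χ h K ↔ ∃ hi : χ i h = 1, (⟨i, hi⟩ : FixedIdx χ h) ∉ K := by
  simp [fixedCompl]

theorem toggle_fixedCompl {h : H} {K : Finset (FixedIdx χ h)} {i : FixedIdx χ h} (hi : i ∉ K) :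
    toggle i.val (fixedCompl χ h K) = fixedCompl χ h (toggle i K) := by
  have h1 : i.val ∈ fixedCompl χ h K := (mem_fixedCompl χ).2 ⟨i.2, hi⟩
  rw [toggle, if_pos h1, toggle, if_neg hi]
  ext l
  simp only [Finset.mem_erase, mem_fixedCompl, Finset.mem_insert, not_or, ne_eq]
  constructor
  · rintro ⟨h2, hl, h3⟩
    exact ⟨hl, fun e => h2 (congrArg Subtype.val e), h3⟩
  · rintro ⟨hl, h2, h3⟩
    exact ⟨fun e => h2 (Subtype.ext e), hl, h3⟩

/-- The elements of `I^h` below `i` are split between `K` and its complement. The discrepancy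
depends on `i` alone, so it can be absorbed in `projSign`. -/
theorem thetaSign_fixedCompl {A : Type*} [CommRing A] {h : H} (K : Finset (FixedIdx χ h))
    (i : FixedIdx χ h) :
    thetaSign A i.val (fixedCompl χ h K) = thetaSign A i Finset.univ * thetaSign A i K := by
  have h1 : thetaSign A i.val (fixedCompl χ h K) = thetaSign A i Kᶜ := by
    rw [thetaSign, thetaSign, fixedCompl, Finset.filter_map, Finset.card_map]
    rfl
  have h2 : thetaSign A i Finset.univ = thetaSign A i Kᶜ * thetaSign A i K := by
    rw [thetaSign, thetaSign, thetaSign, ← pow_add, ← Finset.card_union_of_disjoint]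
    · rw [← Finset.filter_union, Finset.union_comm, Finset.union_compl]
    · exact Finset.disjoint_filter_filter disjoint_compl_left
  rw [h1, h2, mul_assoc, thetaSign_mul_self, mul_one]

/-- The sign by which the projection to the Koszul complex is normalized. -/
def projSign (A : Type*) [CommRing A] {ι : Type*} [LinearOrder ι] [Fintype ι] (K : Finset ι) : A :=
  ∏ i ∈ K, thetaSign A i Finset.univ

theorem projSign_mul_self (A : Type*) [CommRing A] {ι : Type*} [LinearOrder ι] [Fintype ι]
    (K : Finset ι) : projSign A K * projSign A K = 1 := by
  rw [projSign, ← Finset.prod_mul_distrib]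
  exact Finset.prod_eq_one fun i _ => thetaSign_mul_self i _

theorem projSign_toggle (A : Type*) [CommRing A] {ι : Type*} [LinearOrder ι] [Fintype ι]
    {K : Finset ι} {i : ι} (hi : i ∉ K) :
    projSign A (toggle i K) = thetaSign A i Finset.univ * projSign A K := by
  rw [toggle, if_neg hi, projSign, Finset.prod_insert hi, projSign]

theorem dTheta_apply_of_notMem {A : Type*} [CommRing A] {ι : Type*} [LinearOrder ι]
    {J : Finset ι} {i : ι} (hi : i ∉ J) (u : Theta A ι) :
    dTheta A i u J = thetaSign A i J * u (toggle i J) := by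
  simp [dTheta, toggle, hi]

/-- The projection of the complex of morphisms `Δ_W^1 → Δ_W^h` to `K^*(∂W^h) · θ_{I_h}`: the
coefficients of `θ_1 ⋯ θ_n` in the images of the `θ_L`, `L ⊆ I^h`, restricted to the fixed
locus of `h`. -/
def koszulProj (h : H) : ThetaMatrix (DoubleRing k n) (Fin n) →ₛₗ[(restrictS χ h).toRingHom]
    Theta (FixedRing χ h) (FixedIdx χ h) where
  toFun M K := projSign _ K * restrictS χ h (M (Finset.univ, fixedCompl χ h K))
  map_add' M N := by funext K; simp [mul_add]
  map_smul' a M := by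
    funext K
    simp only [Pi.smul_apply, smul_eq_mul, map_mul, AlgHom.toRingHom_eq_coe, RingHom.coe_coe]
    ring

theorem koszulProj_apply (h : H) (M : ThetaMatrix (DoubleRing k n) (Fin n))
    (K : Finset (FixedIdx χ h)) :
    koszulProj χ h M K = projSign _ K * restrictS χ h (M (Finset.univ, fixedCompl χ h K)) := rfl

/-- The projection is a chain map up to the factor `-σ`, which comes from the sign in front of the
row operator. -/
theorem koszulProj_homOp (W : MvPolynomial (Fin n) k) (h : H) (σ : DoubleRing k n)
    (M : ThetaMatrix (DoubleRing k n) (Fin n)) :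
    koszulProj χ h (homOp χ W h σ M) =
      -restrictS χ h σ • koszulD (jacobian χ W h) (koszulProj χ h M) := by
  funext K
  -- Since the first index is the full set, every column term carries some `x_i' - h_i x_i`, which
  -- restricts to zero.
  rw [koszulProj_apply, homOp, LinearMap.sub_apply, LinearMap.smul_apply, Pi.sub_apply,
    Pi.smul_apply, onColumns_cliffordOp_apply, onRows_cliffordOp_apply, map_sub, map_sum,
    Finset.sum_eq_zero (fun i _ => by
      rw [if_pos (Finset.mem_univ i), map_mul, map_mul, restrictS_coeffTheta_self]; ring),
    smul_eq_mul, map_mul, map_sum, Pi.smul_apply, koszulD, LinearMap.sum_apply, Finset.sum_apply,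
    smul_eq_mul, zero_sub, neg_mul, mul_neg, mul_left_comm, Finset.mul_sum]
  congr 2
  symm
  -- Among the row terms, those with `i ∉ L = I^h \ K` carry `x_i' - x_i` and vanish. The rest
  -- correspond to the `i ∈ I^h` outside `K`, as in the Koszul differential.
  refine Finset.sum_of_injOn Subtype.val Subtype.val_injective.injOn (by simp) ?_ ?_
  · intro i _ hi
    have : i ∉ fixedCompl χ h K := fun h1 =>
      hi ⟨⟨i, ((mem_fixedCompl χ).1 h1).1⟩, by simp, rfl⟩
    rw [if_neg this, map_mul, map_mul, restrictS_coeffTheta_one]; ring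
  · intro i _
    rw [LinearMap.smul_apply, Pi.smul_apply, smul_eq_mul]
    by_cases hi : i ∈ K
    · have : i.val ∉ fixedCompl χ h K := fun h1 => ((mem_fixedCompl χ).1 h1).2 hi
      rw [if_neg this, map_mul, map_mul, restrictS_coeffTheta_one]
      simp [dTheta, hi]
    · have : i.val ∈ fixedCompl χ h K := (mem_fixedCompl χ).2 ⟨i.2, hi⟩
      have hs : restrictS χ h (thetaSign (DoubleRing k n) i.val (fixedCompl χ h K)) =
          thetaSign _ i Finset.univ * thetaSign _ i K := by
        rw [← thetaSign_fixedCompl]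
        simp [thetaSign]
      rw [if_pos this, map_mul, map_mul, restrictS_coeffDTheta_one χ i.2, toggle_fixedCompl χ hi,
        hs]
      rw [dTheta_apply_of_notMem hi, koszulProj_apply, projSign_toggle _ hi]
      ring

theorem koszulProj_surjective (h : H) (u : Theta (FixedRing χ h) (FixedIdx χ h)) :
    ∃ M, koszulProj χ h M = u := by
  classical
  have hinj : Function.Injective (fixedCompl χ h) := fun K K' e =>
    compl_injective (Finset.map_injective _ e)
  -- The projection reads the first index only at the full set, so the lift may be taken independent
  -- of it. Positions not of the form `I^h \ K` receive `0`.
  refine ⟨fun x => restrictSection χ h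
    (if hx : ∃ K, fixedCompl χ h K = x.2 then projSign _ hx.choose * u hx.choose else 0), ?_⟩
  funext K
  have hx : ∃ K', fixedCompl χ h K' = fixedCompl χ h K := ⟨K, rfl⟩
  have hK : hx.choose = K := hinj hx.choose_spec
  rw [koszulProj_apply, restrictS_restrictSection]
  rw [dif_pos hx, hK, ← mul_assoc, projSign_mul_self, one_mul]

/-- Membership in all the sets means `J = {1, …, n}` and `L ⊆ I^h`, exactly the entries seen by the
projection. This lets `exact_homOp` be read as acyclicity of its kernel. -/
theorem koszulProj_eq_zero_iff (h : H) (M : ThetaMatrix (DoubleRing k n) (Fin n)) :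
    koszulProj χ h M = 0 ↔ M ∈ (pairSystem n).vanishing (homCoeff χ h)
      (Finset.univ.disjSum (movedIdx χ h)) := by
  have h1 : ∀ K, koszulProj χ h M K = 0 ↔
      restrictS χ h (M (Finset.univ, fixedCompl χ h K)) = 0 := by
    intro K
    rw [koszulProj_apply]
    constructor
    · intro e
      rw [← one_mul (restrictS χ h _), ← projSign_mul_self _ K, mul_assoc, e, mul_zero]
    · intro e
      rw [e, mul_zero]
  constructor
  · rintro hM ⟨J, L⟩ hx
    obtain rfl : J = Finset.univ :=
      Finset.eq_univ_iff_forall.2 fun i => hx (Sum.inl i) (by simp)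
    have hL : ∀ i ∈ L, χ i h = 1 := by
      intro i hi
      by_contra hc
      exact hx (Sum.inr i) (by simpa using (mem_movedIdx χ).2 hc) hi
    obtain ⟨K, rfl⟩ : ∃ K, fixedCompl χ h K = L := by
      refine ⟨Finset.univ.filter fun i => i.val ∉ L, ?_⟩
      ext i
      simp only [mem_fixedCompl, Finset.mem_filter, Finset.mem_univ, true_and, not_not,
        exists_prop, and_iff_right_iff_imp]
      exact hL i
    rw [← ker_restrictS]
    exact (h1 K).1 (congrFun hM K)
  · intro hM
    funext K
    refine (h1 K).2 ?_
    rw [← RingHom.mem_ker, ker_restrictS]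
    refine hM _ ?_
    rintro (i | i) hi
    · exact Finset.mem_univ i
    · intro h2
      exact (mem_movedIdx χ).1 (by simpa using hi) ((mem_fixedCompl χ).1 h2).1

variable {W : MvPolynomial (Fin n) k}

/-- The kernel of the projection to the Koszul complex is acyclic. -/
theorem exists_homOp_eq_of_koszulProj_eq_zero (hW : ∀ h, diagAction χ h W = W) {h : H}
    {σ : DoubleRing k n} (hσ : σ * σ = 1) {M : ThetaMatrix (DoubleRing k n) (Fin n)}
    (hM : homOp χ W h σ M = 0) (hp : koszulProj χ h M = 0) :
    ∃ N, koszulProj χ h N = 0 ∧ homOp χ W h (-σ) N = M := by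
  obtain ⟨N, hN, h1⟩ := exact_homOp χ hW h hσ (add_neg_cancel σ) M
    ((koszulProj_eq_zero_iff χ h M).1 hp) (by rw [← homOp_eq_op, hM])
  exact ⟨N, (koszulProj_eq_zero_iff χ h N).2 hN, by rw [homOp_eq_op, h1]⟩

/-- Every Koszul cocycle is the projection of a closed morphism. -/
theorem exists_koszulProj_eq (hW : ∀ h, diagAction χ h W = W) {h : H} {σ : DoubleRing k n}
    (hσ : σ * σ = 1) {u : Theta (FixedRing χ h) (FixedIdx χ h)}
    (hu : koszulD (jacobian χ W h) u = 0) :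
    ∃ M, homOp χ W h σ M = 0 ∧ koszulProj χ h M = u := by
  obtain ⟨M, rfl⟩ := koszulProj_surjective χ h u
  -- The differential of an arbitrary lift `M` is closed and projects to zero. A primitive of it
  -- inside the kernel corrects `M` without changing its projection.
  obtain ⟨N, hN, h1⟩ := exists_homOp_eq_of_koszulProj_eq_zero χ hW (h := h) (σ := -σ)
    (by rw [neg_mul_neg, hσ]) (M := homOp χ W h σ M)
    (homOp_homOp χ hW h (by rw [neg_mul, hσ]) (neg_add_cancel σ) M)
    (by rw [koszulProj_homOp, hu, smul_zero])
  rw [neg_neg] at h1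
  exact ⟨M - N, by rw [map_sub, h1, sub_self], by rw [map_sub, hN, sub_zero]⟩

/-- A closed morphism whose projection is a coboundary is exact. -/
theorem exists_homOp_eq (hW : ∀ h, diagAction χ h W = W) {h : H} {σ : DoubleRing k n}
    (hσ : σ * σ = 1) {M : ThetaMatrix (DoubleRing k n) (Fin n)} (hM : homOp χ W h σ M = 0)
    {y : Theta (FixedRing χ h) (FixedIdx χ h)}
    (hy : koszulD (jacobian χ W h) y = koszulProj χ h M) :
    ∃ N, homOp χ W h (-σ) N = M := by
  obtain ⟨N, rfl⟩ := koszulProj_surjective χ h y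
  have hσ' : restrictS χ h σ * restrictS χ h σ = 1 := by rw [← map_mul, hσ, map_one]
  -- The factor `σ` cancels the one by which the projection intertwines the differentials, as `σ² =
  -- 1`.
  have h1 : koszulProj χ h (homOp χ W h (-σ) (σ • N)) = koszulProj χ h M := by
    rw [koszulProj_homOp, map_neg, neg_neg, LinearMap.map_smulₛₗ, map_smul, smul_smul, hy]
    exact (congrArg (· • _) hσ').trans (one_smul _ _)
  obtain ⟨N', -, h2⟩ := exists_homOp_eq_of_koszulProj_eq_zero χ hW (h := h) hσ
    (M := M - homOp χ W h (-σ) (σ • N))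
    (by rw [map_sub, hM, homOp_homOp χ hW h (by rw [mul_neg, hσ]) (add_neg_cancel σ), sub_zero])
    (by rw [map_sub, h1, sub_self])
  exact ⟨σ • N + N', by rw [map_add, h2, add_sub_cancel]⟩

end Sector

/-! ### Averaging over a group of diagonal automorphisms -/

section Averaging

variable {k : Type*} [Field k] {n : ℕ} {H : Type*} [CommGroup H] (χ : Fin n → H →* kˣ)

/-- In characteristic `p` an element of order `p` would satisfy `(x_i - 1)^p = x_i^p - 1 = 0` in
every coordinate, hence be trivial. By Cauchy's theorem `p` does not divide the order. -/
theorem natCast_card_ne_zero_of_subgroup_units {ι : Type*} (Γ : Subgroup (ι → kˣ)) [Finite Γ] :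
    (Nat.card Γ : k) ≠ 0 := by
  intro h0
  obtain ⟨p, hp⟩ := CharP.exists k
  have hdvd : p ∣ Nat.card Γ := (CharP.cast_eq_zero_iff k p _).1 h0
  rcases CharP.char_is_prime_or_zero k p with hprime | rfl
  · have : Fact p.Prime := ⟨hprime⟩
    obtain ⟨x, hx⟩ := exists_prime_orderOf_dvd_card' p hdvd
    have hx1 : x = 1 := by
      apply Subtype.ext
      funext i
      apply Units.ext
      have h1 : (x.1 i : k) ^ p = 1 := by
        have := congrArg (fun y : Γ => ((y.1 i : kˣ) : k)) (pow_orderOf_eq_one x)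
        rw [hx] at this
        simpa using this
      have h2 : ((x.1 i : k) - 1) ^ p = 0 := by
        rw [sub_pow_char, h1, one_pow, sub_self]
      exact sub_eq_zero.1 (pow_eq_zero_iff hprime.ne_zero |>.1 h2)
    rw [hx1, orderOf_one] at hx
    exact hprime.one_lt.ne hx
  · exact Nat.card_pos.ne' (Nat.eq_zero_of_zero_dvd hdvd)

/-- Sums over a suitable finite set whose order is invertible average the functions on `H` that
depend only on the values of the characters. -/
theorem exists_averaging_finset [Finite H] (V : Type*) [AddCommMonoid V] :
    ∃ s : Finset H, (s.card : k) ≠ 0 ∧ ∀ (g : H) (f : H → V),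
      (∀ a b, (∀ i, χ i a = χ i b) → f a = f b) → ∑ t ∈ s, f (g * t) = ∑ t ∈ s, f t := by
  classical
  let F : H →* (Fin n → kˣ) := MonoidHom.pi χ
  have : Finite F.range := Finite.of_surjective _ F.rangeRestrict_surjective
  let _ : Fintype F.range := Fintype.ofFinite _
  choose r hr using F.rangeRestrict_surjective
  have hinj : Function.Injective r := Function.LeftInverse.injective hr
  refine ⟨Finset.univ.map ⟨r, hinj⟩, ?_, fun g f hf => ?_⟩
  · rw [Finset.card_map, Finset.card_univ, ← Nat.card_eq_fintype_card]
    exact natCast_card_ne_zero_of_subgroup_units F.range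
  · rw [Finset.sum_map, Finset.sum_map]
    -- The set consists of one representative for each element of the image of `H`. Translation by
    -- `g` need not preserve the representatives, but it permutes their character values.
    refine Fintype.sum_equiv (Equiv.mulLeft (F.rangeRestrict g)) _ _ fun γ => hf _ _ fun i => ?_
    have h1 : F.rangeRestrict (g * r γ) = F.rangeRestrict (r (F.rangeRestrict g * γ)) := by
      rw [map_mul, hr, hr]
    exact congrFun (congrArg Subtype.val h1) i

end Averaging

/-! ### The diagonal action of `H` on matrices -/

section Action

variable {k : Type u} [Field k] {n : ℕ} {H : Type v} [CommGroup H] (χ : Fin n → H →* kˣ)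

theorem thetaWeight_toggle {ι : Type*} [LinearOrder ι] (c : ι → H →* kˣ) (g : H) (J : Finset ι)
    (i : ι) : thetaWeight c g (toggle i J) =
      (if i ∈ J then c i g else (c i g)⁻¹) * thetaWeight c g J := by
  by_cases h : i ∈ J
  · rw [toggle, if_pos h, if_pos h, thetaWeight_erase c g h]
  · rw [toggle, if_neg h, if_neg h, thetaWeight_insert c g h]

theorem doubleAction_diag_coeffTheta (h g : H) (i : Fin n) :
    doubleAction χ (g, g) (coeffTheta χ h i) = C (χ i g : k) * coeffTheta χ h i := by
  simp only [coeffTheta, doubleAction, map_sub, map_mul, diagAction_X, diagAction_C,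
    Sum.elim_inl, Sum.elim_inr, MonoidHom.comp_apply, MonoidHom.coe_fst, MonoidHom.coe_snd]
  ring

theorem doubleAction_mul_apply (g g' : H × H) (p : DoubleRing k n) :
    doubleAction χ (g * g') p = doubleAction χ g (doubleAction χ g' p) :=
  diagAction_mul _ _ _ _

theorem doubleAction_diag_coeffDTheta {W : MvPolynomial (Fin n) k}
    (hW : ∀ h, diagAction χ h W = W) (h g : H) (i : Fin n) :
    doubleAction χ (g, g) (coeffDTheta χ W h i) =
      C ((χ i g)⁻¹ : kˣ).val * coeffDTheta χ W h i := by
  rw [coeffDTheta, ← doubleAction_mul_apply, mul_comm, doubleAction_mul_apply,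
    doubleAction_diag_nabla hW, map_mul, doubleAction, diagAction_C]

/-- The action of `g ∈ H` on the matrices of the linear maps `Δ_W^1 → Δ_W^h`. -/
def matAct (g : H) :
    ThetaMatrix (DoubleRing k n) (Fin n) →+ ThetaMatrix (DoubleRing k n) (Fin n) where
  toFun M x := C (thetaWeight χ g x.1 * (thetaWeight χ g x.2)⁻¹ : kˣ).val *
    doubleAction χ (g, g) (M x)
  map_zero' := by funext x; simp
  map_add' M N := by funext x; simp [mul_add]

theorem matAct_apply (g : H) (M : ThetaMatrix (DoubleRing k n) (Fin n)) (x) :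
    matAct χ g M x = C (thetaWeight χ g x.1 * (thetaWeight χ g x.2)⁻¹ : kˣ).val *
      doubleAction χ (g, g) (M x) := rfl

theorem matAct_mul (g g' : H) (M : ThetaMatrix (DoubleRing k n) (Fin n)) :
    matAct χ (g * g') M = matAct χ g (matAct χ g' M) := by
  funext x
  rw [matAct_apply, matAct_apply, matAct_apply, ← Prod.mk_mul_mk, doubleAction_mul_apply,
    map_mul, thetaWeight_mul, thetaWeight_mul, mul_inv, mul_mul_mul_comm, Units.val_mul, C_mul,
    mul_assoc]
  simp [doubleAction]

/-- This permits averaging over the image of `H` in `(k^*)^n` instead of `H` itself. -/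
theorem matAct_congr {g g' : H} (h : ∀ i, χ i g = χ i g')
    (M : ThetaMatrix (DoubleRing k n) (Fin n)) : matAct χ g M = matAct χ g' M := by
  funext x
  have h1 : ∀ J : Finset (Fin n), thetaWeight χ g J = thetaWeight χ g' J := fun J => by
    simp [thetaWeight, h]
  have h2 : ∀ p : DoubleRing k n, doubleAction χ (g, g) p = doubleAction χ (g', g') p := by
    intro p
    unfold doubleAction
    rw [diagAction_apply, diagAction_apply]
    congr 2
    funext i
    rcases i with i | i <;> simp [h]
  rw [matAct_apply, matAct_apply, h1, h1, h2]

theorem matAct_smul (g : H) (s : DoubleRing k n) (M : ThetaMatrix (DoubleRing k n) (Fin n)) :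
    matAct χ g (s • M) = doubleAction χ (g, g) s • matAct χ g M := by
  funext x
  simp only [matAct_apply, Pi.smul_apply, smul_eq_mul, map_mul]
  ring

/-- The weight `g_i` of `a i` is cancelled by the weight `g_i⁻¹` of the `θ_i` it multiplies, and
dually for `b i` and `∂_{θ_i}`. -/
theorem matAct_onColumns {g : H} {a b : Fin n → DoubleRing k n}
    (ha : ∀ i, doubleAction χ (g, g) (a i) = C (χ i g : k) * a i)
    (hb : ∀ i, doubleAction χ (g, g) (b i) = C ((χ i g)⁻¹ : kˣ).val * b i)
    (M : ThetaMatrix (DoubleRing k n) (Fin n)) :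
    onColumns (cliffordOp a b) (matAct χ g M) = matAct χ g (onColumns (cliffordOp a b) M) := by
  funext ⟨J, L⟩
  rw [onColumns_cliffordOp_apply, matAct_apply, onColumns_cliffordOp_apply, map_sum,
    Finset.mul_sum]
  refine Finset.sum_congr rfl fun i _ => ?_
  have hs : doubleAction χ (g, g) (thetaSign (DoubleRing k n) i J) = thetaSign _ i J := by
    simp [thetaSign]
  rw [matAct_apply, map_mul, map_mul, hs, thetaWeight_toggle]
  by_cases hi : i ∈ J
  · simp only [hi, if_true, ha, Units.val_mul, C_mul]; ring
  · simp only [hi, if_false, hb, Units.val_mul, C_mul]; ring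

theorem matAct_onRows {g : H} {a b : Fin n → DoubleRing k n}
    (ha : ∀ i, doubleAction χ (g, g) (a i) = C ((χ i g)⁻¹ : kˣ).val * a i)
    (hb : ∀ i, doubleAction χ (g, g) (b i) = C (χ i g : k) * b i)
    (M : ThetaMatrix (DoubleRing k n) (Fin n)) :
    onRows (cliffordOp a b) (matAct χ g M) = matAct χ g (onRows (cliffordOp a b) M) := by
  funext ⟨J, L⟩
  rw [onRows_cliffordOp_apply, matAct_apply, onRows_cliffordOp_apply, map_sum, Finset.mul_sum]
  refine Finset.sum_congr rfl fun i _ => ?_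
  have hs : doubleAction χ (g, g) (thetaSign (DoubleRing k n) i L) = thetaSign _ i L := by
    simp [thetaSign]
  rw [matAct_apply, map_mul, map_mul, hs, thetaWeight_toggle, mul_inv]
  by_cases hi : i ∈ L
  · simp only [hi, if_true, ha, Units.val_mul, C_mul]; ring
  · simp only [hi, if_false, hb, Units.val_mul, C_mul, inv_inv]; ring

theorem matAct_homOp {W : MvPolynomial (Fin n) k} (hW : ∀ h, diagAction χ h W = W) (h g : H)
    {σ : DoubleRing k n} (hσ : doubleAction χ (g, g) σ = σ)
    (M : ThetaMatrix (DoubleRing k n) (Fin n)) :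
    homOp χ W h σ (matAct χ g M) = matAct χ g (homOp χ W h σ M) := by
  rw [homOp, LinearMap.sub_apply, LinearMap.smul_apply, LinearMap.sub_apply, LinearMap.smul_apply,
    map_sub, matAct_smul, hσ,
    matAct_onColumns χ (doubleAction_diag_coeffTheta χ h g) (doubleAction_diag_coeffDTheta χ hW h g),
    matAct_onRows χ (doubleAction_diag_coeffDTheta χ hW 1 g) (doubleAction_diag_coeffTheta χ 1 g)]

/-- The set `{1, …, n}` is the disjoint union of `I_h`, `K` and `I^h \ K`. Dividing by the weight of
the source `θ_L`, `L = I^h \ K`, leaves the weight of `θ_K θ_{I_h}`. -/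
theorem thetaWeight_univ (h g : H) (K : Finset (FixedIdx χ h)) :
    thetaWeight χ g Finset.univ = thetaWeight χ g (movedIdx χ h) *
      thetaWeight (fun i : FixedIdx χ h => χ i.val) g K * thetaWeight χ g (fixedCompl χ h K) := by
  classical
  have h1 : thetaWeight χ g (fixedCompl χ h K) =
      thetaWeight (fun i : FixedIdx χ h => χ i.val) g Kᶜ := by
    rw [thetaWeight, fixedCompl, Finset.prod_map]; rfl
  have h2 : thetaWeight (fun i : FixedIdx χ h => χ i.val) g K *
      thetaWeight (fun i : FixedIdx χ h => χ i.val) g Kᶜ =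
        ∏ i ∈ Finset.univ.filter (fun i => ¬ χ i h ≠ 1), (χ i g)⁻¹ := by
    rw [thetaWeight, thetaWeight, Finset.prod_mul_prod_compl]
    exact (Finset.prod_subtype _ (by simp) fun i => (χ i g)⁻¹).symm
  rw [h1, mul_assoc, h2, thetaWeight, thetaWeight, movedIdx,
    ← Finset.prod_filter_mul_prod_filter_not Finset.univ fun i => χ i h ≠ 1]

theorem koszulProj_matAct (h g : H) (M : ThetaMatrix (DoubleRing k n) (Fin n)) :
    koszulProj χ h (matAct χ g M) = sectorAct χ h g (koszulProj χ h M) := by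
  funext K
  have h1 : sectorAct χ h g (koszulProj χ h M) K = C (thetaWeight χ g (movedIdx χ h) *
    thetaWeight (fun i : FixedIdx χ h => χ i.val) g K : kˣ).val *
      fixedAction χ h g (koszulProj χ h M K) := rfl
  have hs : fixedAction χ h g (projSign (FixedRing χ h) K) = projSign _ K := by
    simp [projSign, thetaSign]
  have hC : ∀ a : k, restrictS χ h (C a) = C a := fun a => by simp [restrictS, algebraMap_eq]
  rw [h1, koszulProj_apply, koszulProj_apply, matAct_apply, map_mul, map_mul, hs,
    fixedAction_restrictS, hC, thetaWeight_univ χ h g K, mul_inv_cancel_right]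
  ring

/-- The average of a matrix over the group `H`. -/
theorem exists_average [Finite H] :
    ∃ (s : Finset H) (r : k), r * s.card = 1 ∧
      ∀ (M : ThetaMatrix (DoubleRing k n) (Fin n)) (g : H),
        matAct χ g ((C r : DoubleRing k n) • ∑ t ∈ s, matAct χ t M) =
          (C r : DoubleRing k n) • ∑ t ∈ s, matAct χ t M := by
  obtain ⟨s, hs, h⟩ := exists_averaging_finset χ (ThetaMatrix (DoubleRing k n) (Fin n))
  refine ⟨s, (s.card : k)⁻¹, inv_mul_cancel₀ hs, fun M g => ?_⟩
  rw [matAct_smul, map_sum, ← h g (fun t => matAct χ t M) fun a b hab => matAct_congr χ hab M]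
  simp only [matAct_mul]
  congr 1
  simp [doubleAction]

/-! ### The parity grading on matrices -/

open Classical in
/-- The part of parity `p` of a matrix. -/
def parityProj (A : Type*) [CommRing A] (ι : Type*) (p : ZMod 2) :
    ThetaMatrix A ι →ₗ[A] ThetaMatrix A ι where
  toFun M x := if (x.1.card + x.2.card : ZMod 2) = p then M x else 0
  map_add' M N := by funext x; simp only [Pi.add_apply]; split_ifs <;> simp
  map_smul' a M := by funext x; simp

theorem parityProj_apply {A : Type*} [CommRing A] {ι : Type*} {p : ZMod 2} (M : ThetaMatrix A ι)
    {x} (hx : (x.1.card + x.2.card : ZMod 2) = p) : parityProj A ι p M x = M x := if_pos hx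

theorem parityProj_apply_of_ne {A : Type*} [CommRing A] {ι : Type*} {p : ZMod 2}
    (M : ThetaMatrix A ι) {x} (hx : (x.1.card + x.2.card : ZMod 2) ≠ p) :
    parityProj A ι p M x = 0 := if_neg hx

theorem parityProj_idem {A : Type*} [CommRing A] {ι : Type*} (p : ZMod 2) (M : ThetaMatrix A ι) :
    parityProj A ι p (parityProj A ι p M) = parityProj A ι p M := by
  funext x
  by_cases hx : (x.1.card + x.2.card : ZMod 2) = p
  · rw [parityProj_apply _ hx]
  · rw [parityProj_apply_of_ne _ hx, parityProj_apply_of_ne _ hx]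

theorem parityProj_homOp (W : MvPolynomial (Fin n) k) (h : H) (σ : DoubleRing k n) (p : ZMod 2)
    (M : ThetaMatrix (DoubleRing k n) (Fin n)) :
    homOp χ W h σ (parityProj _ _ p M) = parityProj _ _ (p + 1) (homOp χ W h σ M) := by
  funext ⟨J, L⟩
  have key : ∀ q : ZMod 2, q + 1 = p ↔ q = p + 1 := by revert p; decide
  have h1 : ∀ i, ((toggle i J).card + L.card : ZMod 2) = p ↔
      (J.card + L.card : ZMod 2) = p + 1 := fun i => by
    rw [card_toggle, add_right_comm, key]
  have h2 : ∀ i, (J.card + (toggle i L).card : ZMod 2) = p ↔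
      (J.card + L.card : ZMod 2) = p + 1 := fun i => by
    rw [card_toggle, ← add_assoc, key]
  by_cases hx : (J.card + L.card : ZMod 2) = p + 1
  · rw [parityProj_apply _ hx]
    simp only [homOp, LinearMap.sub_apply, LinearMap.smul_apply, Pi.sub_apply, Pi.smul_apply,
      onColumns_cliffordOp_apply, onRows_cliffordOp_apply,
      parityProj_apply (x := (toggle _ J, L)) M ((h1 _).2 hx),
      parityProj_apply (x := (J, toggle _ L)) M ((h2 _).2 hx)]
  · rw [parityProj_apply_of_ne _ hx]
    simp only [homOp, LinearMap.sub_apply, LinearMap.smul_apply, Pi.sub_apply, Pi.smul_apply,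
      onColumns_cliffordOp_apply, onRows_cliffordOp_apply,
      parityProj_apply_of_ne (x := (toggle _ J, L)) M (mt (h1 _).1 hx),
      parityProj_apply_of_ne (x := (J, toggle _ L)) M (mt (h2 _).1 hx)]
    simp

theorem parityProj_matAct (g : H) (p : ZMod 2) (M : ThetaMatrix (DoubleRing k n) (Fin n)) :
    parityProj _ _ p (matAct χ g M) = matAct χ g (parityProj _ _ p M) := by
  funext x
  by_cases hx : (x.1.card + x.2.card : ZMod 2) = p
  · rw [parityProj_apply _ hx, matAct_apply, matAct_apply, parityProj_apply _ hx]
  · rw [parityProj_apply_of_ne _ hx, matAct_apply, parityProj_apply_of_ne _ hx, map_zero, mul_zero]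

/-- The parity of the entries that contribute to a coefficient of the Koszul projection. -/
theorem parity_fixedCompl (h : H) (K : Finset (FixedIdx χ h)) :
    ((Finset.univ : Finset (Fin n)).card + (fixedCompl χ h K).card : ZMod 2) =
      ((-(K.card : ℤ) - ((movedIdx χ h).card : ℤ) : ℤ) : ZMod 2) := by
  classical
  have h1 : (fixedCompl χ h K).card = Fintype.card (FixedIdx χ h) - K.card := by
    rw [fixedCompl, Finset.card_map, Finset.card_compl]
  have h2 : (movedIdx χ h).card + Fintype.card (FixedIdx χ h) = Fintype.card (Fin n) := by
    rw [Fintype.card_subtype, ← Finset.card_univ (α := Fin n),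
      ← Finset.card_filter_add_card_filter_not (s := Finset.univ) fun i => χ i h ≠ 1, movedIdx]
    congr! 3
    simp
  have h3 : K.card ≤ Fintype.card (FixedIdx χ h) := Finset.card_le_univ K
  -- The same partition of `{1, …, n}` makes the two sides differ by `2n`, which is zero modulo 2.
  have h4 : (Finset.univ : Finset (Fin n)).card + (fixedCompl χ h K).card +
      K.card + (movedIdx χ h).card = 2 * Fintype.card (Fin n) := by
    rw [h1, Finset.card_univ]; omega
  have h5 := congrArg (Nat.cast : ℕ → ZMod 2) h4
  push_cast at h5 ⊢
  rw [show (2 : ZMod 2) = 0 from rfl, zero_mul] at h5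
  linear_combination h5

end Action

/-! ### Equivariant morphisms and invariant matrices -/

section Morphisms

variable {k : Type u} [Field k] {n : ℕ} {H : Type v} [CommGroup H] (χ : Fin n → H →* kˣ)

open Classical in
/-- The basis element `θ_L` of the summand of `g`. -/
def basisVec (k : Type u) [Field k] {n : ℕ} {H : Type v} (g : H) (L : Finset (Fin n)) :
    H → Theta (DoubleRing k n) (Fin n) :=
  fun h J => if g = h ∧ L = J then 1 else 0

theorem basisVec_self {H : Type v} (g : H) (L : Finset (Fin n)) : basisVec k g L g L = 1 :=
  if_pos ⟨rfl, rfl⟩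

theorem basisVec_of_ne {H : Type v} {g h : H} {J L : Finset (Fin n)} (hne : ¬(g = h ∧ L = J)) :
    basisVec k g L h J = 0 := if_neg hne

theorem eq_sum_basisVec {H : Type v} [Fintype H] (x : H → Theta (DoubleRing k n) (Fin n)) :
    x = ∑ g, ∑ L, x g L • basisVec k g L := by
  classical
  funext h J
  simp [Finset.sum_apply, basisVec, ite_and]

theorem diagAct_apply (g : H × H) (x : H → Theta (DoubleRing k n) (Fin n)) (h : H)
    (J : Finset (Fin n)) : diagAct χ g x h J =
      C (thetaWeight χ g.1 J : k) * doubleAction χ g (x (g.1 * g.2⁻¹ * h) J) := rfl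

theorem diagAct_basisVec (a b g : H) (L : Finset (Fin n)) :
    diagAct χ (a, b) (basisVec k g L) =
      (C (thetaWeight χ a L : k) : DoubleRing k n) • basisVec k (a⁻¹ * b * g) L := by
  funext h J
  rw [diagAct_apply]
  have h1 : g = a * b⁻¹ * h ↔ a⁻¹ * b * g = h := by
    rw [show a⁻¹ * b = (a * b⁻¹)⁻¹ by rw [mul_inv, inv_inv], inv_mul_eq_iff_eq_mul]
  by_cases h2 : a⁻¹ * b * g = h ∧ L = J
  · obtain ⟨h2, rfl⟩ := h2
    simp only [basisVec, Pi.smul_apply, h1, h2, and_self, if_true, map_one, smul_eq_mul]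
  · simp only [basisVec, Pi.smul_apply, h1, h2, if_false, map_zero, smul_eq_mul]
    ring

theorem diagAct_smul (g : H × H) (r : DoubleRing k n)
    (x : H → Theta (DoubleRing k n) (Fin n)) :
    diagAct χ g (r • x) = doubleAction χ g r • diagAct χ g x := by
  funext h J
  simp only [diagAct_apply, Pi.smul_apply, smul_eq_mul, map_mul]
  ring

/-- The matrix of the component `Δ_W^1 → Δ_W^h` of a linear map. -/
def toMat (φ : (H → Theta (DoubleRing k n) (Fin n)) →ₗ[DoubleRing k n]
    (H → Theta (DoubleRing k n) (Fin n))) (h : H) : ThetaMatrix (DoubleRing k n) (Fin n) :=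
  fun x => φ (basisVec k 1 x.2) h x.1

/-- The differential of `Δ_W^{H × H}`. -/
def blockD (W : MvPolynomial (Fin n) k) : (H → Theta (DoubleRing k n) (Fin n)) →ₗ[DoubleRing k n]
    (H → Theta (DoubleRing k n) (Fin n)) :=
  LinearMap.pi fun h => diagD χ W h ∘ₗ LinearMap.proj h

theorem thetaSign_toggle {A : Type*} [CommRing A] {ι : Type*} [LinearOrder ι] (i : ι)
    (J : Finset ι) : thetaSign A i (toggle i J) = thetaSign A i J := by
  by_cases h : i ∈ J
  · rw [toggle, if_pos h, thetaSign_erase_self]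
  · rw [toggle, if_neg h, thetaSign_insert_self]

theorem blockD_basisVec (W : MvPolynomial (Fin n) k) (g : H) (L : Finset (Fin n)) :
    blockD χ W (basisVec k g L) = ∑ i, (thetaSign (DoubleRing k n) i L *
      (if i ∈ L then coeffDTheta χ W g i else coeffTheta χ g i)) • basisVec k g (toggle i L) := by
  classical
  funext h J
  have h1 : blockD χ W (basisVec k g L) h J = diagD χ W h (basisVec k g L h) J := rfl
  rw [h1, diagD, cliffordOp_eq_sum_toggle, Finset.sum_apply, Finset.sum_apply]
  refine Finset.sum_congr rfl fun i _ => ?_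
  rw [Pi.smul_apply, Pi.smul_apply, smul_eq_mul]
  have h2 : L = toggle i J ↔ toggle i L = J :=
    ⟨fun e => by rw [e, toggle_toggle], fun e => by rw [← e, toggle_toggle]⟩
  by_cases h3 : g = h ∧ toggle i L = J
  · obtain ⟨rfl, rfl⟩ := h3
    rw [toggle_toggle, basisVec_self, basisVec_self, thetaSign_toggle]
    by_cases hi : i ∈ L
    · rw [if_neg (by rw [mem_toggle_self]; exact not_not.2 hi), if_pos hi]
    · rw [if_pos (by rwa [mem_toggle_self]), if_neg hi]
  · rw [basisVec_of_ne h3, basisVec_of_ne (by rwa [h2]), mul_zero, mul_zero]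

theorem toMat_differential (W : MvPolynomial (Fin n) k) (σ : DoubleRing k n)
    (φ : (H → Theta (DoubleRing k n) (Fin n)) →ₗ[DoubleRing k n]
      (H → Theta (DoubleRing k n) (Fin n))) (h : H) :
    toMat (blockD χ W ∘ₗ φ - σ • (φ ∘ₗ blockD χ W)) h = homOp χ W h σ (toMat φ h) := by
  funext ⟨J, L⟩
  rw [homOp, LinearMap.sub_apply, LinearMap.smul_apply, Pi.sub_apply, Pi.smul_apply,
    onRows_cliffordOp_apply]
  have h1 : toMat (blockD χ W ∘ₗ φ - σ • (φ ∘ₗ blockD χ W)) h (J, L) =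
      diagD χ W h (φ (basisVec k 1 L) h) J - σ • φ (blockD χ W (basisVec k 1 L)) h J := rfl
  rw [h1, blockD_basisVec, map_sum, Finset.sum_apply, Finset.sum_apply]
  congr 2
  refine Finset.sum_congr rfl fun i _ => ?_
  rw [map_smul]; rfl

/-- A diagonal element `(g, g)` preserves every summand, so equivariance under it constrains each
component separately. -/
theorem matAct_toMat {φ : (H → Theta (DoubleRing k n) (Fin n)) →ₗ[DoubleRing k n]
      (H → Theta (DoubleRing k n) (Fin n))}
    (hφ : ∀ g x, φ (diagAct χ g x) = diagAct χ g (φ x)) (h g : H) :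
    matAct χ g (toMat φ h) = toMat φ h := by
  funext ⟨J, L⟩
  have h1 := congrFun (congrFun (hφ (g, g) (basisVec k 1 L)) h) J
  rw [diagAct_basisVec, map_smul, inv_mul_cancel, one_mul, diagAct_apply, mul_inv_cancel, one_mul,
    Pi.smul_apply, Pi.smul_apply, smul_eq_mul] at h1
  have h2 : matAct χ g (toMat φ h) (J, L) = C ((thetaWeight χ g L)⁻¹ : kˣ).val *
      (C (thetaWeight χ g J : k) * doubleAction χ (g, g) (φ (basisVec k 1 L) h J)) := by
    rw [matAct_apply, Units.val_mul, C_mul, mul_comm (C _) (C _), mul_assoc]; rfl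
  rw [h2, ← h1, ← mul_assoc, ← C_mul, Units.inv_mul, C_1, one_mul]
  rfl

/-- The elements `(1, g)` carry `Δ_W^1` onto every summand without rescaling the `θ_L`, whose
weights involve only the first factor. -/
theorem ext_of_toMat [Finite H] {φ ψ : (H → Theta (DoubleRing k n) (Fin n)) →ₗ[DoubleRing k n]
      (H → Theta (DoubleRing k n) (Fin n))}
    (hφ : ∀ g x, φ (diagAct χ g x) = diagAct χ g (φ x))
    (hψ : ∀ g x, ψ (diagAct χ g x) = diagAct χ g (ψ x))
    (h : ∀ h, toMat φ h = toMat ψ h) : φ = ψ := by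
  have := Fintype.ofFinite H
  have h1 : ∀ L, φ (basisVec k 1 L) = ψ (basisVec k 1 L) := fun L => by
    funext g J
    exact congrFun (h g) (J, L)
  have h2 : ∀ g L, basisVec k g L = diagAct χ (1, g) (basisVec k 1 L) := fun g L => by
    rw [diagAct_basisVec]
    simp [thetaWeight]
  refine LinearMap.ext fun x => ?_
  rw [eq_sum_basisVec x]
  simp only [map_sum, map_smul]
  refine Finset.sum_congr rfl fun g _ => Finset.sum_congr rfl fun L _ => ?_
  rw [h2, hφ, hψ, h1]

theorem parityProj_toMat {φ : (H → Theta (DoubleRing k n) (Fin n)) →ₗ[DoubleRing k n]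
      (H → Theta (DoubleRing k n) (Fin n))} {j : ZMod 2}
    (hφ : ∀ i x, x ∈ diagGrading H (DoubleRing k n) n i →
      φ x ∈ diagGrading H (DoubleRing k n) n (i + j)) (h : H) :
    parityProj _ _ j (toMat φ h) = toMat φ h := by
  funext ⟨J, L⟩
  by_cases hx : (J.card + L.card : ZMod 2) = j
  · rw [parityProj_apply _ hx]
  · rw [parityProj_apply_of_ne _ hx]
    by_contra h0
    refine hx ?_
    have hb : basisVec k (1 : H) L ∈ diagGrading H (DoubleRing k n) n (L.card : ZMod 2) := by
      intro g _ J' hJ'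
      by_contra hc
      refine hJ' (if_neg ?_)
      rintro ⟨-, rfl⟩
      exact hc rfl
    have h1 : (J.card : ZMod 2) = L.card + j := hφ _ _ hb h trivial J (Ne.symm h0)
    rw [h1, add_right_comm, CharTwo.add_self_eq_zero, zero_add]

/-- The linear map with given components `Δ_W^1 → Δ_W^h`, extended by equivariance. -/
def ofMat [Fintype H] (M : H → ThetaMatrix (DoubleRing k n) (Fin n)) :
    (H → Theta (DoubleRing k n) (Fin n)) →ₗ[DoubleRing k n]
      (H → Theta (DoubleRing k n) (Fin n)) where
  toFun x h J := ∑ g, ∑ L, x g L * doubleAction χ (1, g) (M (g⁻¹ * h) (J, L))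
  map_add' x y := by
    funext h J
    simp [add_mul, Finset.sum_add_distrib]
  map_smul' a x := by
    funext h J
    simp [Finset.mul_sum, mul_assoc]

theorem ofMat_apply [Fintype H] (M : H → ThetaMatrix (DoubleRing k n) (Fin n)) (x) (h : H) (J) :
    ofMat χ M x h J = ∑ g, ∑ L, x g L * doubleAction χ (1, g) (M (g⁻¹ * h) (J, L)) := rfl

theorem toMat_ofMat [Fintype H] (M : H → ThetaMatrix (DoubleRing k n) (Fin n)) (h : H) :
    toMat (ofMat χ M) h = M h := by
  classical
  funext ⟨J, L⟩
  have h1 : toMat (ofMat χ M) h (J, L) = ofMat χ M (basisVec k 1 L) h J := rfl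
  rw [h1, ofMat_apply, Finset.sum_eq_single 1, Finset.sum_eq_single L]
  · simp only [basisVec, and_self, if_true, inv_one, one_mul]
    rw [← Prod.one_eq_mk, map_one]; rfl
  · intro L' _ hL
    simp [basisVec, hL.symm]
  · simp
  · intro g _ hg
    simp [basisVec, hg.symm]
  · simp

/-- Invariance under the stabilizer of `Δ_W^1` suffices for the extension by translates to be
equivariant under all of `H × H`. -/
theorem ofMat_diagAct [Fintype H] {M : H → ThetaMatrix (DoubleRing k n) (Fin n)}
    (hM : ∀ h g, matAct χ g (M h) = M h) (g : H × H) (x) :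
    ofMat χ M (diagAct χ g x) = diagAct χ g (ofMat χ M x) := by
  obtain ⟨a, b⟩ := g
  funext h J
  rw [ofMat_apply, diagAct_apply, ofMat_apply, map_sum, Finset.mul_sum]
  refine Fintype.sum_equiv (Equiv.mulLeft (a * b⁻¹)) _ _ fun g => ?_
  rw [map_sum, Finset.mul_sum]
  refine Finset.sum_congr rfl fun L _ => ?_
  have hg : (a * b⁻¹ * g)⁻¹ * (a * b⁻¹ * h) = g⁻¹ * h := by
    rw [mul_inv, mul_mul_mul_comm, inv_mul_cancel, one_mul]
  rw [diagAct_apply, Equiv.coe_mulLeft, hg, map_mul, ← doubleAction_mul_apply, Prod.mk_mul_mk]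
  -- Here `(a, b)` followed by the coset representative is rewritten as a representative times a
  -- diagonal element, to which the invariance of `M` applies.
  have h1 : ((a * 1, b * (a * b⁻¹ * g)) : H × H) = (1, g) * (a, a) := by
    ext
    · simp
    · simp only [Prod.snd_mul]
      rw [mul_comm a b⁻¹, mul_assoc, mul_inv_cancel_left, mul_comm]
  have h2 : C (thetaWeight χ a J : k) * doubleAction χ (a, a) (M (g⁻¹ * h) (J, L)) =
      C (thetaWeight χ a L : k) * M (g⁻¹ * h) (J, L) := by
    conv_rhs => rw [← hM (g⁻¹ * h) a, matAct_apply]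
    rw [Units.val_mul, C_mul, mul_comm (C _) (C _), mul_assoc, ← mul_assoc, ← C_mul,
      Units.mul_inv, C_1, one_mul]
  have h3 := congrArg (doubleAction χ (1, g)) h2
  rw [map_mul, map_mul] at h3
  have hC : ∀ c : k, doubleAction χ (1, g) (C c) = C c := fun c => by simp [doubleAction]
  rw [hC, hC] at h3
  rw [h1, doubleAction_mul_apply]
  linear_combination (-doubleAction χ (a, b) (x (a * b⁻¹ * g) L)) * h3

theorem ofMat_mem_diagGrading [Fintype H] {M : H → ThetaMatrix (DoubleRing k n) (Fin n)}
    {j : ZMod 2} (hM : ∀ h, parityProj _ _ j (M h) = M h) (i : ZMod 2) (x)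
    (hx : x ∈ diagGrading H (DoubleRing k n) n i) :
    ofMat χ M x ∈ diagGrading H (DoubleRing k n) n (i + j) := by
  intro h _ J hJ
  obtain ⟨g, -, hg⟩ := Finset.exists_ne_zero_of_sum_ne_zero hJ
  obtain ⟨L, -, hL⟩ := Finset.exists_ne_zero_of_sum_ne_zero hg
  have h1 : (L.card : ZMod 2) = i := hx g trivial L (left_ne_zero_of_mul hL)
  have h2 : (J.card + L.card : ZMod 2) = j := by
    by_contra hc
    refine right_ne_zero_of_mul hL ?_
    rw [← hM, parityProj_apply_of_ne _ hc, map_zero]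
  rw [← h1, ← h2, add_comm (J.card : ZMod 2), ← add_assoc, CharTwo.add_self_eq_zero, zero_add]

end Morphisms

/-! ### Homogeneous components of the Koszul complex -/

section DegPart

variable {A : Type*} [CommRing A] {ι : Type*}

/-- The component of degree `i`. -/
def degPart (i : ℤ) : Theta A ι →ₗ[A] Theta A ι where
  toFun u K := if -(K.card : ℤ) = i then u K else 0
  map_add' u v := by funext K; simp only [Pi.add_apply]; split_ifs <;> simp
  map_smul' a u := by funext K; simp

theorem degPart_apply {i : ℤ} (u : Theta A ι) {K : Finset ι} (hK : -(K.card : ℤ) = i) :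
    degPart i u K = u K := if_pos hK

theorem degPart_apply_of_ne {i : ℤ} (u : Theta A ι) {K : Finset ι} (hK : -(K.card : ℤ) ≠ i) :
    degPart i u K = 0 := if_neg hK

theorem degPart_mem (i : ℤ) (u : Theta A ι) : degPart i u ∈ koszulDeg A ι i := by
  intro K hK
  by_contra hc
  exact hK (degPart_apply_of_ne u hc)

theorem eq_of_degPart {u v : Theta A ι} (h : ∀ i, degPart i u = degPart i v) : u = v := by
  funext K
  have := congrFun (h (-(K.card : ℤ))) K
  rwa [degPart_apply u rfl, degPart_apply v rfl] at this

theorem degPart_of_sum {v : ℤ → Theta A ι} (hv : ∀ i, v i ∈ koszulDeg A ι i) (i : ℤ) :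
    degPart i (fun K : Finset ι => v (-(K.card : ℤ)) K) = v i := by
  funext K
  by_cases hK : -(K.card : ℤ) = i
  · rw [degPart_apply _ hK, hK]
  · rw [degPart_apply_of_ne _ hK]
    by_contra h0
    exact hK (hv i K (Ne.symm h0))

variable [LinearOrder ι] [Fintype ι]

/-- The value of the differential at `K` involves sets with one more element, that is, of degree one
lower. -/
theorem koszulD_degPart (r : ι → A) (i : ℤ) (u : Theta A ι) :
    koszulD r (degPart (i - 1) u) = degPart i (koszulD r u) := by
  funext K
  have h1 : ∀ l ∉ K, -((toggle l K).card : ℤ) = i - 1 ↔ -(K.card : ℤ) = i := by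
    intro l hl
    rw [toggle, if_neg hl, Finset.card_insert_of_notMem hl]
    push_cast
    constructor <;> intro h <;> linarith
  have h2 : ∀ v : Theta A ι, koszulD r v K =
      ∑ l, r l * (if l ∈ K then 0 else thetaSign A l K * v (toggle l K)) := by
    intro v
    rw [koszulD, LinearMap.sum_apply, Finset.sum_apply]
    refine Finset.sum_congr rfl fun l _ => ?_
    rw [LinearMap.smul_apply, Pi.smul_apply, smul_eq_mul]
    split_ifs with hl
    · simp [dTheta, hl]
    · rw [dTheta_apply_of_notMem hl]
  by_cases hK : -(K.card : ℤ) = i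
  · rw [degPart_apply _ hK, h2, h2]
    refine Finset.sum_congr rfl fun l _ => ?_
    split_ifs with hl
    · rfl
    · rw [degPart_apply _ ((h1 l hl).2 hK)]
  · rw [degPart_apply_of_ne _ hK, h2]
    refine Finset.sum_eq_zero fun l _ => ?_
    split_ifs with hl
    · rw [mul_zero]
    · rw [degPart_apply_of_ne _ (mt (h1 l hl).1 hK), mul_zero, mul_zero]

end DegPart

/-! ### The class of a closed morphism in the Koszul cohomology -/

section ClosedClass

variable {k : Type u} [Field k] {n : ℕ} {H : Type v} [CommGroup H] (χ : Fin n → H →* kˣ)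

variable (k n) in
/-- The sign `(-1)^j`. -/
def paritySign (j : ZMod 2) : DoubleRing k n := (-1) ^ j.val

theorem paritySign_mul_self (j : ZMod 2) : paritySign k n j * paritySign k n j = 1 := by
  rw [paritySign, ← mul_pow]; simp

theorem paritySign_sub_one (j : ZMod 2) : paritySign k n (j - 1) = -paritySign k n j := by
  have h : ∀ j : ZMod 2, (j.val = 0 ∧ (j - 1).val = 1) ∨ (j.val = 1 ∧ (j - 1).val = 0) := by
    decide
  rcases h j with ⟨h1, h2⟩ | ⟨h1, h2⟩ <;> simp [paritySign, h1, h2]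

theorem doubleAction_paritySign (g : H × H) (j : ZMod 2) :
    doubleAction χ g (paritySign k n j) = paritySign k n j := by
  simp [paritySign]

theorem degPart_sectorAct (h g : H) (i : ℤ) (u : Theta (FixedRing χ h) (FixedIdx χ h)) :
    degPart i (sectorAct χ h g u) = sectorAct χ h g (degPart i u) := by
  funext K
  have h1 : ∀ v, sectorAct χ h g v K = C (thetaWeight χ g (movedIdx χ h) *
    thetaWeight (fun i : FixedIdx χ h => χ i.val) g K : kˣ).val *
      fixedAction χ h g (v K) := fun v => rfl
  by_cases hK : -(K.card : ℤ) = i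
  · rw [degPart_apply _ hK, h1, h1, degPart_apply _ hK]
  · rw [degPart_apply_of_ne _ hK, h1, degPart_apply_of_ne _ hK, map_zero, mul_zero]

variable (W : MvPolynomial (Fin n) k)

variable {W} in
theorem degPart_koszulProj_mem {h : H} {j : ZMod 2} {M : ThetaMatrix (DoubleRing k n) (Fin n)}
    (hM : homOp χ W h (paritySign k n j) M = 0) (i : ℤ) :
    degPart i (koszulProj χ h M) ∈ koszulCocycles (jacobian χ W h) i := by
  refine ⟨?_, degPart_mem _ _⟩
  have h1 : koszulD (jacobian χ W h) (koszulProj χ h M) = 0 := by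
    have h2 := koszulProj_homOp χ W h (paritySign k n j) M
    have h3 : restrictS χ h (paritySign k n j) * restrictS χ h (paritySign k n j) = 1 := by
      rw [← map_mul, paritySign_mul_self, map_one]
    rw [hM, map_zero] at h2
    calc _ = (restrictS χ h (paritySign k n j) * restrictS χ h (paritySign k n j)) •
          koszulD (jacobian χ W h) (koszulProj χ h M) := by rw [h3, one_smul]
      _ = -restrictS χ h (paritySign k n j) • (-restrictS χ h (paritySign k n j) •
          koszulD (jacobian χ W h) (koszulProj χ h M)) := by rw [smul_smul, neg_mul_neg]
      _ = 0 := by rw [← h2, smul_zero]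
  have h4 := koszulD_degPart (jacobian χ W h) (i + 1) (koszulProj χ h M)
  rw [h1, map_zero, add_sub_cancel_right] at h4
  exact h4

/-- The class in `H^i(K^*(∂W^h)) · θ_{I_h}` of a closed morphism `Δ_W^1 → Δ_W^h`. -/
def closedClass (h : H) (j : ZMod 2) (i : ℤ) :
    LinearMap.ker (homOp χ W h (paritySign k n j)) →ₗ[DoubleRing k n] Sector χ W h i where
  toFun M := (koszulCoboundaries (jacobian χ W h) i).submoduleOf
    (koszulCocycles (jacobian χ W h) i) |>.mkQ
      ⟨degPart i (koszulProj χ h M.1), degPart_koszulProj_mem χ M.2 i⟩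
  map_add' M N := by
    refine (congrArg _ (Subtype.ext ?_)).trans (map_add (Submodule.mkQ _) _ _)
    change degPart i (koszulProj χ h (M.1 + N.1)) = _ + _
    rw [map_add, map_add]
  map_smul' s M := by
    refine (congrArg _ (Subtype.ext ?_)).trans
      (map_smul (Submodule.mkQ _) (restrictS χ h s) _)
    change degPart i (koszulProj χ h (s • M.1)) =
      restrictS χ h s • degPart i (koszulProj χ h M.1)
    rw [LinearMap.map_smulₛₗ, map_smul]
    rfl

theorem closedClass_apply {h : H} {j : ZMod 2} {i : ℤ}
    (M : LinearMap.ker (homOp χ W h (paritySign k n j))) :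
    closedClass χ W h j i M = ((koszulCoboundaries (jacobian χ W h) i).submoduleOf
      (koszulCocycles (jacobian χ W h) i)).mkQ
        ⟨degPart i (koszulProj χ h M.1), degPart_koszulProj_mem χ M.2 i⟩ := rfl

theorem closedClass_eq_zero_iff {h : H} {j : ZMod 2} {i : ℤ}
    (M : LinearMap.ker (homOp χ W h (paritySign k n j))) :
    closedClass χ W h j i M = 0 ↔ ∃ y ∈ koszulDeg (FixedRing χ h) (FixedIdx χ h) (i - 1),
      koszulD (jacobian χ W h) y = degPart i (koszulProj χ h M.1) :=
  Submodule.Quotient.mk_eq_zero _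

/-- The projected primitive is rescaled by the sign from `koszulProj_homOp`, and its component of
degree `i - 1` bounds. -/
theorem closedClass_homOp {h : H} {j : ZMod 2} {i : ℤ}
    {M : LinearMap.ker (homOp χ W h (paritySign k n j))}
    {N : ThetaMatrix (DoubleRing k n) (Fin n)}
    (hN : homOp χ W h (paritySign k n (j - 1)) N = M.1) : closedClass χ W h j i M = 0 := by
  rw [closedClass_eq_zero_iff]
  refine ⟨degPart (i - 1) (-restrictS χ h (paritySign k n (j - 1)) • koszulProj χ h N),
    degPart_mem _ _, ?_⟩
  rw [koszulD_degPart, map_smul, ← hN, koszulProj_homOp]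

variable {W}

/-- The action of `g` on the closed morphisms `Δ_W^1 → Δ_W^h`. -/
def closedAct (hW : ∀ h, diagAction χ h W = W) (h : H) (j : ZMod 2) (g : H)
    (M : LinearMap.ker (homOp χ W h (paritySign k n j))) :
    LinearMap.ker (homOp χ W h (paritySign k n j)) :=
  ⟨matAct χ g M.1, by
    rw [LinearMap.mem_ker, matAct_homOp χ hW h g (doubleAction_paritySign χ _ j),
      LinearMap.mem_ker.1 M.2, map_zero]⟩

theorem coe_closedAct (hW : ∀ h, diagAction χ h W = W) (h : H) (j : ZMod 2) (g : H)
    (M : LinearMap.ker (homOp χ W h (paritySign k n j))) :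
    (closedAct χ hW h j g M).1 = matAct χ g M.1 := rfl

theorem closedClass_closedAct (hW : ∀ h, diagAction χ h W = W) (h : H) (j : ZMod 2) (i : ℤ)
    (g : H) (M : LinearMap.ker (homOp χ W h (paritySign k n j))) :
    closedClass χ W h j i (closedAct χ hW h j g M) =
      sectorCohomologyAct hW h g i (closedClass χ W h j i M) := by
  rw [closedClass_apply]
  refine (congrArg (Submodule.mkQ _) (Subtype.ext ?_)).trans (b := Submodule.mkQ _
    (cocycleAct hW h g i ⟨degPart i (koszulProj χ h M.1), degPart_koszulProj_mem χ M.2 i⟩)) rfl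
  change degPart i (koszulProj χ h (matAct χ g M.1)) =
    sectorAct χ h g (degPart i (koszulProj χ h M.1))
  rw [koszulProj_matAct, degPart_sectorAct]

/-- All entries contributing in Koszul degree `i` have parity `i - |I_h|`, by `parity_fixedCompl`.
-/
theorem degPart_koszulProj_eq_zero {h : H} {j : ZMod 2} {i : ℤ}
    {M : ThetaMatrix (DoubleRing k n) (Fin n)} (hM : parityProj _ _ j M = M)
    (hi : ((i - ((movedIdx χ h).card : ℤ) : ℤ) : ZMod 2) ≠ j) :
    degPart i (koszulProj χ h M) = 0 := by
  funext K
  by_cases hK : -(K.card : ℤ) = i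
  · rw [degPart_apply _ hK, koszulProj_apply, ← hM, parityProj_apply_of_ne, map_zero, mul_zero,
      Pi.zero_apply]
    rwa [parity_fixedCompl, hK]
  · rw [degPart_apply_of_ne _ hK, Pi.zero_apply]

theorem degPart_koszulProj_parityProj {h : H} {j : ZMod 2} {i : ℤ}
    (M : ThetaMatrix (DoubleRing k n) (Fin n))
    (hi : ((i - ((movedIdx χ h).card : ℤ) : ℤ) : ZMod 2) = j) :
    degPart i (koszulProj χ h (parityProj _ _ j M)) = degPart i (koszulProj χ h M) := by
  funext K
  by_cases hK : -(K.card : ℤ) = i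
  · rw [degPart_apply _ hK, degPart_apply _ hK, koszulProj_apply, koszulProj_apply,
      parityProj_apply]
    rwa [parity_fixedCompl, hK]
  · rw [degPart_apply_of_ne _ hK, degPart_apply_of_ne _ hK]

/-- Invariant classes are represented by invariant closed morphisms. -/
theorem exists_closedClass_eq [Finite H] (hW : ∀ h, diagAction χ h W = W) (h : H) (j : ZMod 2)
    (c : ∀ i : ℤ, ((i - ((movedIdx χ h).card : ℤ) : ℤ) : ZMod 2) = j → Sector χ W h i)
    (hc : ∀ g i hi, sectorCohomologyAct hW h g i (c i hi) = c i hi) :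
    ∃ M : LinearMap.ker (homOp χ W h (paritySign k n j)), parityProj _ _ j M.1 = M.1 ∧
      (∀ g, matAct χ g M.1 = M.1) ∧ ∀ i hi, closedClass χ W h j i M = c i hi := by
  classical
  have hz : ∀ i : ℤ, ∃ z : koszulCocycles (jacobian χ W h) i,
      ∀ hi, ((koszulCoboundaries (jacobian χ W h) i).submoduleOf
        (koszulCocycles (jacobian χ W h) i)).mkQ z = c i hi := by
    intro i
    by_cases hi : ((i - ((movedIdx χ h).card : ℤ) : ℤ) : ZMod 2) = j
    · obtain ⟨z, hz⟩ := Submodule.mkQ_surjective _ (c i hi)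
      exact ⟨z, fun _ => hz⟩
    -- In degrees of the wrong parity no class is prescribed, and zero is used.
    · exact ⟨0, fun h => absurd h hi⟩
  choose z hz using hz
  have hdeg := degPart_of_sum fun i => (z i).2.2
  -- The representatives of all degrees are glued into one element, whose value at `K` comes from
  -- degree `-|K|`, and lifted together.
  obtain ⟨M, hM, hMz⟩ := exists_koszulProj_eq χ hW (h := h) (paritySign_mul_self (k := k) (n := n) j)
    (u := fun K => (z (-(K.card : ℤ))).1 K) (eq_of_degPart fun i => by
      rw [← koszulD_degPart, hdeg, map_zero]
      exact (z (i - 1)).2.1)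
  have hM' : homOp χ W h (paritySign k n j) (parityProj _ _ j M) = 0 := by
    rw [parityProj_homOp, hM, map_zero]
  have hcM : ∀ i hi, closedClass χ W h j i ⟨parityProj _ _ j M, hM'⟩ = c i hi := by
    intro i hi
    rw [← hz i hi, closedClass_apply]
    refine congrArg _ (Subtype.ext ?_)
    change degPart i (koszulProj χ h (parityProj _ _ j M)) = (z i).1
    rw [degPart_koszulProj_parityProj χ M hi, hMz, hdeg]
  obtain ⟨s, r, hr, havg⟩ := exists_average (k := k) χ
  refine ⟨(C r : DoubleRing k n) • ∑ t ∈ s, closedAct χ hW h j t ⟨parityProj _ _ j M, hM'⟩,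
    ?_, fun g => ?_, fun i hi => ?_⟩
  · simp only [Submodule.coe_smul, Submodule.coe_sum, coe_closedAct, map_smul, map_sum,
      parityProj_matAct, parityProj_idem]
  · simpa only [Submodule.coe_smul, Submodule.coe_sum, coe_closedAct] using havg (parityProj _ _ j M) g
  -- Each translate still has class `c`, by invariance of `c`, so the sum has class `|s| c` and `r
  -- |s| = 1`.
  · rw [map_smul, map_sum, Finset.sum_congr rfl fun t _ => by
      rw [closedClass_closedAct, hcM i hi, hc], Finset.sum_const, ← Nat.cast_smul_eq_nsmul
      (DoubleRing k n), smul_smul, ← C_eq_coe_nat, ← C_mul, hr, C_1, one_smul]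

/-- An invariant closed morphism whose classes vanish is the differential of an invariant
morphism. -/
theorem exists_homOp_eq_of_closedClass_eq_zero [Finite H] (hW : ∀ h, diagAction χ h W = W) (h : H)
    (j : ZMod 2) (M : LinearMap.ker (homOp χ W h (paritySign k n j)))
    (hM : parityProj _ _ j M.1 = M.1) (hinv : ∀ g, matAct χ g M.1 = M.1)
    (h0 : ∀ i : ℤ, ((i - ((movedIdx χ h).card : ℤ) : ℤ) : ZMod 2) = j →
      closedClass χ W h j i M = 0) :
    ∃ N, parityProj _ _ (j - 1) N = N ∧ (∀ g, matAct χ g N = N) ∧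
      homOp χ W h (paritySign k n (j - 1)) N = M.1 := by
  classical
  -- A primitive of degree `i` bounds the component of degree `i + 1`. In the wrong parity that
  -- component is zero, and so is the primitive.
  have hy : ∀ i : ℤ, ∃ y ∈ koszulDeg (FixedRing χ h) (FixedIdx χ h) i,
      koszulD (jacobian χ W h) y = degPart (i + 1) (koszulProj χ h M.1) := by
    intro i
    by_cases hi : ((i + 1 - ((movedIdx χ h).card : ℤ) : ℤ) : ZMod 2) = j
    · simpa using (closedClass_eq_zero_iff χ W M).1 (h0 (i + 1) hi)
    · exact ⟨0, zero_mem _, by rw [map_zero, degPart_koszulProj_eq_zero χ hM hi]⟩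
  choose y hy hyD using hy
  have hdeg := degPart_of_sum hy
  obtain ⟨N, hN⟩ := exists_homOp_eq χ hW (paritySign_mul_self j) M.2
    (y := fun K => y (-(K.card : ℤ)) K) (eq_of_degPart fun i => by
      rw [← koszulD_degPart, hdeg, hyD, sub_add_cancel])
  have hN' : homOp χ W h (-paritySign k n j) (parityProj _ _ (j - 1) N) = M.1 := by
    rw [parityProj_homOp, hN, sub_add_cancel, hM]
  obtain ⟨s, r, hr, havg⟩ := exists_average (k := k) χ
  refine ⟨(C r : DoubleRing k n) • ∑ t ∈ s, matAct χ t (parityProj _ _ (j - 1) N), ?_,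
    havg _, ?_⟩
  · simp only [map_smul, map_sum, parityProj_matAct, parityProj_idem]
  -- Averaging the primitive keeps its differential, because `M` is invariant.
  · rw [paritySign_sub_one, map_smul, map_sum, Finset.sum_congr rfl fun t _ => by
      rw [matAct_homOp χ hW h t (by rw [map_neg, doubleAction_paritySign]), hN', hinv],
      Finset.sum_const, ← Nat.cast_smul_eq_nsmul
      (DoubleRing k n), smul_smul, ← C_eq_coe_nat, ← C_mul, hr, C_1, one_smul]

end ClosedClass

/-! ### Comparison of the two modules -/

section Comparison

variable {k : Type u} [Field k] {n : ℕ} {H : Type v} [CommGroup H] [Finite H]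
  {χ : Fin n → H →* kˣ} {W : MvPolynomial (Fin n) k} (hW : ∀ h, diagAction χ h W = W)

/-- A morphism of matrix factorizations as a linear map. -/
def toLin (φ : (diagonalMF χ hW).carrier →ₗ[DoubleRing k n] (diagonalMF χ hW).carrier) :
    (H → Theta (DoubleRing k n) (Fin n)) →ₗ[DoubleRing k n]
      (H → Theta (DoubleRing k n) (Fin n)) := φ

theorem toMat_homD (j : ZMod 2)
    (φ : (diagonalMF χ hW).carrier →ₗ[DoubleRing k n] (diagonalMF χ hW).carrier) (h : H) :
    toMat (toLin hW (homD (diagonalMF χ hW) (diagonalMF χ hW) j φ)) h =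
      homOp χ W h (paritySign k n j) (toMat (toLin hW φ) h) :=
  toMat_differential χ W (paritySign k n j) (toLin hW φ) h

variable {hW}

theorem equivariant_of_mem {j : ZMod 2}
    {φ : (diagonalMF χ hW).carrier →ₗ[DoubleRing k n] (diagonalMF χ hW).carrier}
    (hφ : φ ∈ homDeg (diagonalMF χ hW) (diagonalMF χ hW) j) (g : H × H)
    (x : H → Theta (DoubleRing k n) (Fin n)) :
    toLin hW φ (diagAct χ g x) = diagAct χ g (toLin hW φ x) := hφ.1 g x

theorem homD_equivariant {j i : ZMod 2}
    {φ : (diagonalMF χ hW).carrier →ₗ[DoubleRing k n] (diagonalMF χ hW).carrier}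
    (hφ : φ ∈ homDeg (diagonalMF χ hW) (diagonalMF χ hW) j) (g : H × H)
    (x : H → Theta (DoubleRing k n) (Fin n)) :
    toLin hW (homD (diagonalMF χ hW) (diagonalMF χ hW) i φ) (diagAct χ g x) =
      diagAct χ g (toLin hW (homD (diagonalMF χ hW) (diagonalMF χ hW) i φ) x) := by
  have hd : ∀ y, blockD χ W (diagAct χ g y) = diagAct χ g (blockD χ W y) := fun y =>
    ((diagonalMF χ hW).act_d g y).symm
  change blockD χ W (toLin hW φ (diagAct χ g x)) -
      paritySign k n i • toLin hW φ (blockD χ W (diagAct χ g x)) =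
    diagAct χ g (blockD χ W (toLin hW φ x) - paritySign k n i • toLin hW φ (blockD χ W x))
  rw [equivariant_of_mem hφ, hd, hd, equivariant_of_mem hφ, map_sub, diagAct_smul,
    doubleAction_paritySign]

theorem exists_mem_homDeg (j : ZMod 2) {M : H → ThetaMatrix (DoubleRing k n) (Fin n)}
    (hp : ∀ h, parityProj _ _ j (M h) = M h) (hM : ∀ h g, matAct χ g (M h) = M h) :
    ∃ φ ∈ homDeg (diagonalMF χ hW) (diagonalMF χ hW) j, ∀ h, toMat (toLin hW φ) h = M h := by
  have := Fintype.ofFinite H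
  exact ⟨ofMat χ M, ⟨ofMat_diagAct χ hM, ofMat_mem_diagGrading χ hp⟩, toMat_ofMat χ M⟩

/-- The matrix of the component `Δ_W^1 → Δ_W^h` of a closed morphism. -/
def cocycleMat {j : ZMod 2} (h : H)
    (φ : homCocycles (diagonalMF χ hW) (diagonalMF χ hW) j) :
    LinearMap.ker (homOp χ W h (paritySign k n j)) :=
  ⟨toMat (toLin hW φ.1) h, by
    rw [LinearMap.mem_ker, ← toMat_homD, LinearMap.mem_ker.1 φ.2.1]; rfl⟩

theorem matAct_cocycleMat {j : ZMod 2} (h g : H)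
    (φ : homCocycles (diagonalMF χ hW) (diagonalMF χ hW) j) :
    matAct χ g (cocycleMat h φ).1 = (cocycleMat h φ).1 :=
  matAct_toMat χ (equivariant_of_mem φ.2.2) h g

/-- The finite set of the pairs `(h, i)` for which `K^i(∂W^h)` can be nonzero. -/
def sectorSupport (χ : Fin n → H →* kˣ) (j : ZMod 2) : Finset (SectorIdx χ j) :=
  Set.Finite.toFinset (s := {p : SectorIdx χ j | p.1.2 ∈ Set.Icc (-(n : ℤ)) 0}) <| by
    refine Set.Finite.of_finite_image (f := Subtype.val) ?_ Subtype.val_injective.injOn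
    refine ((Set.finite_univ (α := H)).prod (Set.finite_Icc (-(n : ℤ)) 0)).subset ?_
    rintro _ ⟨p, hp, rfl⟩
    exact ⟨trivial, hp⟩

/-- The Koszul complex lives in degrees between `-n` and `0`. Hence finitely many classes describe a
morphism and the direct sum can receive them. -/
theorem closedClass_eq_zero_of_notMem {j : ZMod 2} {p : SectorIdx χ j}
    (hp : p ∉ sectorSupport χ j)
    (M : LinearMap.ker (homOp χ W p.1.1 (paritySign k n j))) :
    closedClass χ W p.1.1 j p.1.2 M = 0 := by
  rw [closedClass_eq_zero_iff]
  refine ⟨0, zero_mem _, ?_⟩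
  rw [map_zero]
  funext K
  rw [degPart_apply_of_ne, Pi.zero_apply]
  intro hK
  refine hp ?_
  rw [sectorSupport, Set.Finite.mem_toFinset, Set.mem_ofPred_eq, ← hK]
  have h1 : K.card ≤ n := by
    refine (Finset.card_le_univ K).trans ?_
    simpa using Fintype.card_le_of_injective (Subtype.val : FixedIdx χ p.1.1 → Fin n)
      Subtype.val_injective
  constructor <;> omega

open Classical in
/-- The class of a closed morphism in `⨁_h H^*(K^*(∂W^h)) · θ_{I_h}`. -/
def toKos (hW : ∀ h, diagAction χ h W = W) (j : ZMod 2) :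
    homCocycles (diagonalMF χ hW) (diagonalMF χ hW) j
      →ₗ[invariants (doubleAction (k := k) χ)] SectorSum χ W j where
  toFun φ := DirectSum.mk _ (sectorSupport χ j)
    fun p => closedClass χ W p.1.1.1 j p.1.1.2 (cocycleMat p.1.1.1 φ)
  map_add' φ ψ := by
    rw [← map_add]
    congr 1
    funext p
    exact map_add (closedClass χ W p.1.1.1 j p.1.1.2) (cocycleMat p.1.1.1 φ)
      (cocycleMat p.1.1.1 ψ)
  map_smul' s φ := by
    refine (congrArg _ (funext fun p => ?_)).trans ((DirectSum.lmk (DoubleRing k n) (SectorIdx χ j)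
      (fun p => Sector χ W p.1.1 p.1.2) (sectorSupport χ j)).map_smul s.1 _)
    exact map_smul (closedClass χ W p.1.1.1 j p.1.1.2) s.1 (cocycleMat p.1.1.1 φ)

theorem toKos_apply {j : ZMod 2} (φ : homCocycles (diagonalMF χ hW) (diagonalMF χ hW) j)
    (p : SectorIdx χ j) :
    toKos hW j φ p = closedClass χ W p.1.1 j p.1.2 (cocycleMat p.1.1 φ) := by
  classical
  have h1 : toKos hW j φ = DirectSum.mk (fun p : SectorIdx χ j => Sector χ W p.1.1 p.1.2)
    (sectorSupport χ j) fun p => closedClass χ W p.1.1.1 j p.1.1.2 (cocycleMat p.1.1.1 φ) := rfl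
  by_cases hp : p ∈ sectorSupport χ j
  · rw [h1, DirectSum.mk_apply_of_mem hp]
  · rw [h1, DirectSum.mk_apply_of_notMem hp, closedClass_eq_zero_of_notMem hp]

theorem toKos_mem {j : ZMod 2} (φ : homCocycles (diagonalMF χ hW) (diagonalMF χ hW) j) :
    toKos hW j φ ∈ Kos hW j := by
  intro g p
  rw [toKos_apply, ← closedClass_closedAct]
  congr 1
  exact Subtype.ext (matAct_cocycleMat _ g φ)

/-- Vanishing classes give an invariant primitive for each component, and these assemble to an
equivariant morphism. -/
theorem toKos_eq_zero_iff {j : ZMod 2}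
    (φ : homCocycles (diagonalMF χ hW) (diagonalMF χ hW) j) :
    toKos hW j φ = 0 ↔ φ.1 ∈ homCoboundaries (diagonalMF χ hW) (diagonalMF χ hW) j := by
  constructor
  · intro h0
    have h1 : ∀ h, ∃ N, parityProj _ _ (j - 1) N = N ∧ (∀ g, matAct χ g N = N) ∧
        homOp χ W h (paritySign k n (j - 1)) N = toMat (toLin hW φ.1) h := by
      intro h
      refine exists_homOp_eq_of_closedClass_eq_zero χ hW h j (cocycleMat h φ)
        (parityProj_toMat φ.2.2.2 h) (fun g => matAct_cocycleMat h g φ) fun i hi => ?_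
      have := toKos_apply φ ⟨(h, i), hi⟩
      rw [h0] at this
      exact this.symm
    choose N hN1 hN2 hN3 using h1
    obtain ⟨ψ, hψ, hψN⟩ := exists_mem_homDeg (hW := hW) (j - 1) hN1 hN2
    refine ⟨ψ, hψ, ?_⟩
    -- Both morphisms are equivariant, so it is enough to compare their components on `Δ_W^1`.
    refine ext_of_toMat χ (homD_equivariant hψ) (equivariant_of_mem φ.2.2) fun h => ?_
    refine (toMat_homD hW (j - 1) ψ h).trans ?_
    rw [hψN, hN3]
    rfl
  · rintro ⟨ψ, hψ, h⟩
    refine DFinsupp.ext fun p => ?_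
    refine (toKos_apply φ p).trans (closedClass_homOp χ W (N := toMat (toLin hW ψ) p.1.1) ?_)
    rw [← toMat_homD, h]
    rfl

/-- Invariant closed representatives are chosen for each `h` separately. Extended by equivariance
they form a single morphism, closed because its components on `Δ_W^1` are. -/
theorem exists_toKos_eq {j : ZMod 2} {c : SectorSum χ W j} (hc : c ∈ Kos hW j) :
    ∃ φ, toKos hW j φ = c := by
  have h1 : ∀ h, ∃ M : LinearMap.ker (homOp χ W h (paritySign k n j)),
      parityProj _ _ j M.1 = M.1 ∧ (∀ g, matAct χ g M.1 = M.1) ∧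
        ∀ i hi, closedClass χ W h j i M = c ⟨(h, i), hi⟩ :=
    fun h => exists_closedClass_eq χ hW h j (fun i hi => c ⟨(h, i), hi⟩)
      fun g i hi => hc g ⟨(h, i), hi⟩
  choose M hM1 hM2 hM3 using h1
  obtain ⟨φ, hφ, hφM⟩ := exists_mem_homDeg (hW := hW) j hM1 hM2
  have hD : homD (diagonalMF χ hW) (diagonalMF χ hW) j φ = 0 := by
    refine ext_of_toMat χ (homD_equivariant hφ) (ψ := 0) (fun g x => (map_zero _).symm)
      fun h => ?_
    refine (toMat_homD hW j φ h).trans ?_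
    rw [hφM, LinearMap.mem_ker.1 (M h).2]
    rfl
  refine ⟨⟨φ, hD, hφ⟩, DFinsupp.ext fun p => (toKos_apply _ p).trans ?_⟩
  rw [← hM3 p.1.1 p.1.2 p.2]
  congr 1
  exact Subtype.ext (hφM p.1.1)

variable (hW) in
/-- The isomorphism between the morphisms of `Δ_W^{H × H}` and the orbifold Koszul cohomology. -/
def homMFEquivKos (j : ZMod 2) : HomMF (diagonalMF χ hW) (diagonalMF χ hW) j
    ≃ₗ[invariants (doubleAction (k := k) χ)] Kos hW j :=
  (Submodule.quotEquivOfEq _ _ (by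
    ext φ
    rw [LinearMap.mem_ker, ← Subtype.coe_inj]
    exact (toKos_eq_zero_iff φ).symm)).trans
  (((toKos hW j).codRestrict (Kos hW j) toKos_mem).quotKerEquivOfSurjective (by
    rintro ⟨c, hc⟩
    obtain ⟨φ, hφ⟩ := exists_toKos_eq hc
    exact ⟨φ, Subtype.ext hφ⟩))

end Comparison

end OrbifoldLG

end
/-- For a polynomial `W` invariant under a diagonal action of a finite abelian group `H`, the
`ℤ/2`-graded module `Hom_{MF_{H × H}(W ⊟ W)}(Δ_W^{H × H}, Δ_W^{H × H})` over `S^{H × H}` is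
isomorphic to `(⨁_h H^*(K^*(∂W^h)) · θ_{I_h})^H`. -/
theorem mainTheorem8 {k : Type*} [Field k] {n : ℕ} {H : Type*} [CommGroup H] [Finite H]
    (χ : Fin n → H →* kˣ) (W : MvPolynomial (Fin n) k)
    (hW : ∀ h, OrbifoldLG.diagAction χ h W = W) (j : ZMod 2) :
    Nonempty (OrbifoldLG.HomMF (OrbifoldLG.diagonalMF χ hW) (OrbifoldLG.diagonalMF χ hW) j
      ≃ₗ[OrbifoldLG.invariants (OrbifoldLG.doubleAction (k := k) χ)]
        OrbifoldLG.Kos hW j) :=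
  ⟨OrbifoldLG.homMFEquivKos hW j⟩
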